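/- **Setting.** Let $\Sigma$ be a finite alphabet and $k\ge 1$ an integer, both known to two parties. In the problem $\mathrm{LCP}^k$, Alice holds a string $A$ over $\Sigma$ and Bob holds $k$ strings $B_1,\dots,B_k$ over $\Sigma$ (of arbitrary finite lengths that the other party does not know). The goal is to compute $\ell=\max_i \mathrm{LCP}(A,B_i)$, where $\mathrm{LCP}(S,T)$ is the length of the longest common prefix of $S$ and $T$. Let $z$ be the number of phrases in the LZ77 parse without self-references of the prefix $A[1,\ell]$. This parse is built greedily from left to right: the next phrase is the longest prefix of the remaining string that occurs as a substring of the part already parsed, plus the following symbol (if the string ends before that symbol, the last phrase has no such symbol). In a public-coin protocol, the parties share an infinite sequence of independent unbiased coin tosses and are otherwise deterministic. The coins and the bits exchanged so far determine who sends the next bit, or that the protocol stops, and in the latter case they determine the output. Each bit sent is a function of its sender's input, the coins and the bits exchanged so far. The communication is the number of bits sent, and the number of rounds is the number of maximal blocks of consecutive bits sent by the same party. **Theorem.** For every $0<\epsilon<1/2$ there is a constant $C$, depending only on $\epsilon$, such that for every finite alphabet $\Sigma$ and every $k\ge1$ there is one public-coin protocol for $\mathrm{LCP}^k$ that stops on all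 inputs and all coin sequences and has the following property: for all $A,B_1,\dots,B_k$, with probability at least $1-\epsilon$ over the coins, the output is $\ell$, at most $C\lg(z+2)$ rounds are used, and at most $C\bigl(\lg(z+2)\,\lg k+\lg(\ell+2)\bigr)$ bits are communicated. That is, $\mathrm{LCP}^k$ has a randomized public-coin protocol with $O(\lg z)$ rounds and $O(\lg z\lg k+\lg\ell)$ communication. -/

import Mathlib

open MeasureTheory

/-! ### Strings: longest common prefixes and the LZ77 parse -/

/-- The length of the longest common prefix of two strings. -/
def lcp {α : Type*} [DecidableEq α] : List α → List α → ℕ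
  | a :: s, b :: t => if a = b then lcp s t + 1 else 0
  | _, _ => 0

/-- The maximum of `lcp A (B i)` over the `k` strings `B i`. -/
def maxLcp {α : Type*} [DecidableEq α] {k : ℕ} (A : List α) (B : Fin k → List α) : ℕ :=
  Finset.univ.sup fun i => lcp A (B i)

/-- The length of the longest prefix of `rest` that has an occurrence lying entirely inside the
already parsed part `past` (so the source does not overlap the phrase: no self-references). -/
def copyLen {α : Type*} [DecidableEq α] (past rest : List α) : ℕ :=
  Nat.findGreatest (fun l => rest.take l <:+: past) rest.length

/-- Greedy LZ77 parsing of `rest` when `past` has already been parsed: the next phrase is the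
longest prefix of `rest` with an occurrence inside `past`, plus the following symbol (if there is
one; the last phrase may be cut off by the end of the string). -/
def lz77From {α : Type*} [DecidableEq α] (past : List α) : List α → List (List α)
  | [] => []
  | a :: t =>
    (a :: t).take (copyLen past (a :: t) + 1) ::
      lz77From (past ++ (a :: t).take (copyLen past (a :: t) + 1))
        (t.drop (copyLen past (a :: t)))
  termination_by rest => rest.length
  decreasing_by simp

/-- The list of phrases of the LZ77 parse (without self-references) of a string. -/
def lz77 {α : Type*} [DecidableEq α] (S : List α) : List (List α) := lz77From [] S

/-! ### Public-coin two-party protocols -/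

/-- Infinite sequences of coin tosses. -/
abbrev Coins : Type := ℕ → Bool

/-- The law of an infinite sequence of independent unbiased coin tosses. -/
noncomputable def coinMeasure : Measure Coins :=
  Measure.infinitePi fun _ : ℕ => (PMF.uniformOfFintype Bool).toMeasure

/-- The two players. -/
inductive Player : Type
  | alice
  | bob
  deriving DecidableEq

/-- The bits sent so far, with their senders, most recent bit first. -/
abbrev Transcript : Type := List (Player × Bool)

/-- The number of bits communicated. -/
def Transcript.bits (h : Transcript) : ℕ := h.length

/-- The number of rounds: a round is a maximal block of consecutive bits with the same sender. -/
def Transcript.rounds : Transcript → ℕ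
  | [] => 0
  | [_] => 1
  | a :: b :: t => Transcript.rounds (b :: t) + if a.1 = b.1 then 0 else 1

/-- A public-coin protocol for Alice with input in `X` and Bob with input in `Y`. Both see the coin
sequence and the transcript, and these two alone determine who speaks next (`none`: the protocol
stops) and the output. The bit sent may also depend on the input of its sender. -/
structure PublicCoinProtocol (X Y Z : Type*) where
  next : Coins → Transcript → Option Player
  aliceBit : X → Coins → Transcript → Bool
  bobBit : Y → Coins → Transcript → Bool
  output : Coins → Transcript → Z
  measurableSet_next : ∀ h p, MeasurableSet {ω | next ω h = p}
  measurableSet_aliceBit : ∀ x h b, MeasurableSet {ω | aliceBit x ω h = b}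
  measurableSet_bobBit : ∀ y h b, MeasurableSet {ω | bobBit y ω h = b}
  measurableSet_output : ∀ h z, MeasurableSet {ω | output ω h = z}

namespace PublicCoinProtocol

variable {X Y Z : Type*}

/-- The transcripts that occur in the execution on inputs `x`, `y` and coins `ω`. -/
inductive Reaches (P : PublicCoinProtocol X Y Z) (x : X) (y : Y) (ω : Coins) : Transcript → Prop
  | start : Reaches P x y ω []
  | alice (h : Transcript) : Reaches P x y ω h → P.next ω h = some Player.alice →
      Reaches P x y ω ((Player.alice, P.aliceBit x ω h) :: h)
  | bob (h : Transcript) : Reaches P x y ω h → P.next ω h = some Player.bob →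
      Reaches P x y ω ((Player.bob, P.bobBit y ω h) :: h)

/-- The execution on inputs `x`, `y` and coins `ω` stops with transcript `h`. -/
def StopsWith (P : PublicCoinProtocol X Y Z) (x : X) (y : Y) (ω : Coins) (h : Transcript) : Prop :=
  P.Reaches x y ω h ∧ P.next ω h = none

end PublicCoinProtocol

/-! ### Longest common prefixes -/

section Lcp

variable {α : Type*} [DecidableEq α]

/-! Let m be the largest number of initial phrases that A shares with some `B j`. A phrase that ends
with its extra symbol is determined by the text up to its end. Hence the first m phrases lie in
A[1,ℓ] and m ≤ z (`le_length_lz77_take_maxLcp`). Moreover ℓ does not pass the copied part of the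
next phrase of A, as otherwise some `B j` would share that phrase too
(`maxLcp_le_of_not_sharesPhrases`). So once m is known, Alice sends a hash of her first m phrases
together with the source and length of the next copied part. Bob picks strings with matching
phrases, rebuilds a prefix of A of length at least ℓ, and returns ℓ (`finish_spec`). The source lies
in a text of length at most ℓ, so apart from the hash this costs O(lg ℓ) bits.

To find m, one compares hashes of lg k + O(1) bits of the first i phrases. Equal lists have equal
hashes, so the only errors are false "yes" answers, each of small constant probability. The tests i
= 2^(2^s) for s = 0, 1, ... go on until the first "no"; then, with D = 2^s = O(lg z), m < 2^D is
sought by 4D queries. The binary search checks its left end and backtracks, and a potential argument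
shows that it tolerates D/2 false answers (`searchResult_eq`), so no query needs amplification.

The questions are adaptive, so failure is bounded by a union over all 2^(4D) answer histories. A
fixed history fixes the questions, and these use disjoint coins, so more than D/2 collisions have
probability at most 2^(-(a+4)D) (`coinMeasure_manyErrors_le`). Only two other collisions matter: in
the last doubling test and in the final hash. -/

theorem lcp_le_length_left (s t : List α) : lcp s t ≤ s.length := by
  induction s generalizing t with
  | nil => simp [lcp]
  | cons a s ih =>
    cases t with
    | nil => simp [lcp]
    | cons b t =>
      have := ih t
      simp only [lcp, List.length_cons]
      split <;> omega

theorem take_lcp_prefix (s t : List α) : s.take (lcp s t) <+: t := by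
  induction s generalizing t with
  | nil => simp
  | cons a s ih =>
    cases t with
    | nil => simp [lcp]
    | cons b t =>
      simp only [lcp]
      split
      · next h => subst h; simpa using ih t
      · simp

theorem length_le_lcp {p s t : List α} (hs : p <+: s) (ht : p <+: t) : p.length ≤ lcp s t := by
  induction p generalizing s t with
  | nil => simp
  | cons a p ih =>
    obtain ⟨s', rfl⟩ := hs
    obtain ⟨t', rfl⟩ := ht
    have := ih (List.prefix_append p s') (List.prefix_append p t')
    simpa [lcp] using this

theorem take_prefix_of_le_lcp {s t : List α} {n : ℕ} (h : n ≤ lcp s t) : s.take n <+: t :=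
  (List.take_prefix_take_left h).trans (take_lcp_prefix s t)

theorem lcp_take (s t : List α) (n : ℕ) : lcp (s.take n) t = min n (lcp s t) := by
  apply le_antisymm
  · refine le_min ((lcp_le_length_left _ _).trans (by simp)) ?_
    have h := length_le_lcp ((List.take_prefix _ (s.take n)).trans (List.take_prefix n s))
      (take_lcp_prefix (s.take n) t)
    have h' := lcp_le_length_left (s.take n) t
    rwa [List.length_take, min_eq_left h'] at h
  · have h1 : s.take (min n (lcp s t)) <+: s.take n := List.take_prefix_take_left (min_le_left _ _)
    have h2 : s.take (min n (lcp s t)) <+: t := take_prefix_of_le_lcp (min_le_right _ _)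
    have h := length_le_lcp h1 h2
    rw [List.length_take, min_eq_left ((min_le_right _ _).trans (lcp_le_length_left _ _))] at h
    exact h

/-- Any prefix of A of length at least ℓ has the same maximum, so Bob can compute ℓ from such a
prefix. -/
theorem maxLcp_take {k : ℕ} (A : List α) (B : Fin k → List α) (n : ℕ) :
    maxLcp (A.take n) B = min n (maxLcp A B) := by
  simp only [maxLcp, lcp_take]
  exact (Finset.sup_inf_distrib_left _ _ _).symm

theorem exists_lcp_eq_maxLcp {k : ℕ} (hk : 1 ≤ k) (A : List α) (B : Fin k → List α) :
    ∃ j, lcp A (B j) = maxLcp A B := by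
  have : Nonempty (Fin k) := ⟨⟨0, hk⟩⟩
  obtain ⟨j, -, hj⟩ := Finset.exists_mem_eq_sup Finset.univ Finset.univ_nonempty
    (fun i => lcp A (B i))
  exact ⟨j, hj.symm⟩

theorem lcp_le_maxLcp {k : ℕ} (A : List α) (B : Fin k → List α) (j : Fin k) :
    lcp A (B j) ≤ maxLcp A B :=
  Finset.le_sup (f := fun i => lcp A (B i)) (Finset.mem_univ j)

theorem maxLcp_le_length {k : ℕ} (A : List α) (B : Fin k → List α) : maxLcp A B ≤ A.length :=
  Finset.sup_le fun _ _ => lcp_le_length_left _ _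

end Lcp

/-! ### The LZ77 parse -/

section Parse

variable {α : Type*} [DecidableEq α]

theorem copyLen_le_length (past rest : List α) : copyLen past rest ≤ rest.length :=
  Nat.findGreatest_le _

theorem take_copyLen_infix (past rest : List α) : rest.take (copyLen past rest) <:+: past :=
  Nat.findGreatest_spec (P := fun l => rest.take l <:+: past) (Nat.zero_le _) (by simp)

theorem le_copyLen {past rest : List α} {n : ℕ} (hn : n ≤ rest.length)
    (h : rest.take n <:+: past) : n ≤ copyLen past rest :=
  Nat.le_findGreatest hn h

theorem copyLen_le_length_past (past rest : List α) : copyLen past rest ≤ past.length := by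
  have h := (take_copyLen_infix past rest).length_le
  rwa [List.length_take, min_eq_left (copyLen_le_length _ _)] at h

/-- The copied part of a phrase can be described by a source position in the parsed part. -/
theorem exists_source (past rest : List α) :
    ∃ a ≤ past.length, (past.drop a).take (copyLen past rest) = rest.take (copyLen past rest) := by
  have hle := copyLen_le_length past rest
  obtain ⟨s, t, h⟩ := take_copyLen_infix past rest
  generalize copyLen past rest = n at *
  refine ⟨s.length, ?_, ?_⟩
  · rw [← h]; simp
  · rw [← h, List.append_assoc, List.drop_left, List.take_append_of_le_length (by simp [hle]),
      List.take_take, min_self]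

/-- A complete phrase (one with a following symbol) depends only on its own symbols. -/
theorem copyLen_eq_of_take_prefix {past rest rest' : List α}
    (hlt : copyLen past rest < rest.length)
    (h : rest.take (copyLen past rest + 1) <+: rest') :
    copyLen past rest' = copyLen past rest := by
  have hlen : (rest.take (copyLen past rest + 1)).length = copyLen past rest + 1 := by
    rw [List.length_take]; omega
  have htake : ∀ n ≤ copyLen past rest + 1, rest'.take n = rest.take n := by
    intro n hn
    obtain ⟨t, rfl⟩ := h
    rw [List.take_append_of_le_length (by omega), List.take_take, min_eq_left hn]
  have hlen' := h.length_le
  apply le_antisymm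
  -- A longer copy would place the next symbol's prefix, which `rest` also has, inside `past`,
  -- against maximality for `rest`.
  · by_contra! hgt
    have h1 : rest'.take (copyLen past rest + 1) <:+: past :=
      ((List.take_prefix_take_left (by omega)).isInfix).trans (take_copyLen_infix past rest')
    rw [htake _ le_rfl] at h1
    have := le_copyLen (by omega) h1
    omega
  · apply le_copyLen (by omega)
    rw [htake _ (by omega)]
    exact take_copyLen_infix past rest

theorem lz77From_nil (past : List α) : lz77From past [] = [] := by
  rw [lz77From]

theorem lz77From_eq_cons (past : List α) {rest : List α} (h : rest ≠ []) :
    lz77From past rest = rest.take (copyLen past rest + 1) ::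
      lz77From (past ++ rest.take (copyLen past rest + 1))
        (rest.drop (copyLen past rest + 1)) := by
  cases rest with
  | nil => exact absurd rfl h
  | cons a t => rw [lz77From]; simp

/-- The only state of the parser is the text already parsed, so a parse can be cut after any phrase
and resumed. -/
theorem lz77From_eq_take_append (i : ℕ) (past rest : List α) :
    lz77From past rest = (lz77From past rest).take i ++
      lz77From (past ++ ((lz77From past rest).take i).flatten)
        (rest.drop ((lz77From past rest).take i).flatten.length) ∧
    ((lz77From past rest).take i).flatten <+: rest := by
  induction i generalizing past rest with
  | zero => simp
  | succ i ih =>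
    rcases eq_or_ne rest [] with rfl | h
    · simp [lz77From_nil]
    · obtain ⟨h1, h2⟩ := ih (past ++ rest.take (copyLen past rest + 1))
        (rest.drop (copyLen past rest + 1))
      rw [lz77From_eq_cons past h]
      set p := rest.take (copyLen past rest + 1) with hp
      set r := rest.drop (copyLen past rest + 1) with hr
      have hpr : rest = p ++ r := (List.take_append_drop _ _).symm
      constructor
      · simp only [List.take_succ_cons, List.flatten_cons, List.cons_append, List.cons.injEq,
          true_and]
        have hd : rest.drop (p ++ ((lz77From (past ++ p) r).take i).flatten).length =
            r.drop ((lz77From (past ++ p) r).take i).flatten.length := by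
          rw [List.length_append, hpr]
          simp [List.drop_append]
        rw [hd, ← List.append_assoc]
        exact h1
      · simp only [List.take_succ_cons, List.flatten_cons]
        conv_rhs => rw [hpr]
        exact (List.prefix_append_right_inj p).2 h2

/-- Phrases are nonempty. This gives z ≤ ℓ, which lets the part of the hashing cost independent of k
be absorbed in lg ℓ. -/
theorem length_lz77From_le (past rest : List α) : (lz77From past rest).length ≤ rest.length := by
  induction hn : rest.length using Nat.strong_induction_on generalizing past rest with
  | _ n ih =>
    rcases eq_or_ne rest [] with rfl | h
    · simp [lz77From_nil]
    · have hpos := List.length_pos_iff.2 h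
      have := ih (rest.drop (copyLen past rest + 1)).length (by simp; omega)
        (past ++ rest.take (copyLen past rest + 1)) _ rfl
      rw [lz77From_eq_cons past h, List.length_cons]
      simp only [List.length_drop] at this
      omega

/-- Each phrase at most doubles the length of the parsed part. -/
theorem length_flatten_take_lz77From (i : ℕ) (past rest : List α) :
    past.length + ((lz77From past rest).take i).flatten.length + 1 ≤
      2 ^ i * (past.length + 1) := by
  induction i generalizing past rest with
  | zero => simp
  | succ i ih =>
    rcases eq_or_ne rest [] with rfl | h
    · simp only [lz77From_nil, List.take_nil, List.flatten_nil, List.length_nil]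
      nlinarith [Nat.one_le_two_pow (n := i + 1)]
    · have h1 := ih (past ++ rest.take (copyLen past rest + 1))
        (rest.drop (copyLen past rest + 1))
      rw [lz77From_eq_cons past h]
      simp only [List.take_succ_cons, List.flatten_cons, List.length_append] at h1 ⊢
      have h2 : (rest.take (copyLen past rest + 1)).length ≤ past.length + 1 := by
        have := copyLen_le_length_past past rest
        rw [List.length_take]; omega
      calc _ ≤ 2 ^ i * (past.length + (rest.take (copyLen past rest + 1)).length + 1) := by omega
        _ ≤ 2 ^ i * (2 * (past.length + 1)) := by gcongr; omega
        _ = _ := by ring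

/-- Phrases that do not reach the end of a string are phrases of every string which starts
with them. -/
theorem take_lz77From_eq_of_prefix (i : ℕ) (past : List α) {s t : List α}
    (hlt : ((lz77From past s).take i).flatten.length < s.length)
    (h : ((lz77From past s).take i).flatten <+: t) :
    (lz77From past t).take i = (lz77From past s).take i := by
  induction i generalizing past s t with
  | zero => simp
  | succ i ih =>
    have hs : s ≠ [] := by rintro rfl; simp at hlt
    rw [lz77From_eq_cons past hs] at hlt h ⊢
    simp only [List.take_succ_cons, List.flatten_cons, List.length_append] at hlt h ⊢
    have hc : copyLen past s < s.length := by
      rw [List.length_take] at hlt; omega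
    have hp : s.take (copyLen past s + 1) <+: t := (List.prefix_append _ _).trans h
    have hplen : (s.take (copyLen past s + 1)).length = copyLen past s + 1 := by
      rw [List.length_take]; omega
    have hce := copyLen_eq_of_take_prefix hc hp
    have ht : t ≠ [] := by
      rintro rfl
      have := hp.length_le
      simp only [List.length_nil] at this
      omega
    have htake : t.take (copyLen past s + 1) = s.take (copyLen past s + 1) := by
      conv_lhs => rw [← hplen]
      exact (List.prefix_iff_eq_take.1 hp).symm
    rw [lz77From_eq_cons past ht, hce, htake, List.take_succ_cons]
    congr 1
    apply ih
    · rw [List.length_drop]; omega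
    · rw [← List.take_append_drop (copyLen past s + 1) t, htake] at h
      exact (List.prefix_append_right_inj _).1 h

end Parse

/-! ### Binary search with one-sided errors -/

/-- The number of answers `true` (in a history with the most recent answer first) to the questions
`idx _ ≤ m` that are wrong. -/
def falseYes (idx : List Bool → ℕ) (m : ℕ) : List Bool → ℕ
  | [] => 0
  | a :: h => falseYes idx m h + if a = true ∧ m < idx h then 1 else 0

/-- All answers `false` in the history are correct. -/
def TruthfulNo (idx : List Bool → ℕ) (m : ℕ) : List Bool → Prop
  | [] => True
  | a :: h => TruthfulNo idx m h ∧ (idx h ≤ m → a = true)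

/-- The left end of the dyadic subinterval of `[0, 2 ^ D)` reached by a path in the binary tree
(last step first). -/
def nodeLo (D : ℕ) : List Bool → ℕ
  | [] => 0
  | b :: w => nodeLo D w + if b then 2 ^ (D - w.length) / 2 else 0

/-- The walk in the binary tree directed by the answers. At each node it is first verified that
the left end is not too large; if so the middle is probed, otherwise the walk backtracks. The
second component tells whether the next question is a probe. -/
def searchWalk : List Bool → List Bool × Bool
  | [] => ([], false)
  | a :: h =>
    if (searchWalk h).2 then (a :: (searchWalk h).1, false)
    else if a then ((searchWalk h).1, true) else ((searchWalk h).1.tail, false)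

/-- The next index to be compared with the unknown number. -/
def searchIndex (D : ℕ) (h : List Bool) : ℕ :=
  nodeLo D (searchWalk h).1 +
    if (searchWalk h).2 then 2 ^ (D - (searchWalk h).1.length) / 2 else 0

/-- The result of the search. -/
def searchResult (D : ℕ) (h : List Bool) : ℕ := nodeLo D (searchWalk h).1

/-- The number `m` lies in the interval of the node. -/
def OnPath (D m : ℕ) (w : List Bool) : Prop :=
  nodeLo D w ≤ m ∧ m < nodeLo D w + 2 ^ (D - w.length)

open Classical in
/-- The depth of the deepest ancestor on the path to `m`, minus the distance to it. -/
noncomputable def progress (D m : ℕ) : List Bool → ℤ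
  | [] => 0
  | b :: w => if OnPath D m (b :: w) then w.length + 1 else progress D m w - 1

open Classical in
/-- The potential function of the search. -/
noncomputable def potential (D m : ℕ) (s : List Bool × Bool) : ℤ :=
  if s.2 then (if OnPath D m s.1 then 2 * progress D m s.1 + 1 else 2 * progress D m s.1 - 3)
  else 2 * progress D m s.1

/-! ### Potential analysis of the backtracking search -/

section Search

variable {D m : ℕ}

theorem progress_le_length (w : List Bool) : progress D m w ≤ w.length := by
  induction w with
  | nil => simp [progress]
  | cons b w ih =>
    simp only [progress, List.length_cons]
    split <;> push_cast <;> omega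

theorem progress_sub_one_le (b : Bool) (w : List Bool) :
    progress D m w - 1 ≤ progress D m (b :: w) := by
  have := progress_le_length (D := D) (m := m) w
  simp only [progress]
  split <;> omega

theorem progress_eq_length {w : List Bool} (h : OnPath D m w) :
    progress D m w = w.length := by
  cases w with
  | nil => rfl
  | cons b w => simp [progress, h]

/-- Above depth D intervals are truly halved. From depth D on they have length 1 and half-length 0,
so the tree continues with copies of its leaves, whose extra depth stores a surplus of correct
answers. -/
theorem two_pow_sub_half (D n : ℕ) :
    (n < D ∧ 2 ^ (D - n) = 2 * 2 ^ (D - (n + 1)) ∧ 2 ^ (D - n) / 2 = 2 ^ (D - (n + 1))) ∨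
      (D ≤ n ∧ 2 ^ (D - n) = 1 ∧ 2 ^ (D - (n + 1)) = 1 ∧ 2 ^ (D - n) / 2 = 0) := by
  rcases lt_or_ge n D with h | h
  · left
    have : D - n = D - (n + 1) + 1 := by omega
    rw [this, pow_succ]
    omega
  · right
    have h1 : D - n = 0 := by omega
    have h2 : D - (n + 1) = 0 := by omega
    simp [h1, h2, h]

theorem nodeHi_cons_le (b : Bool) (w : List Bool) :
    nodeLo D (b :: w) + 2 ^ (D - (b :: w).length) ≤ nodeLo D w + 2 ^ (D - w.length) := by
  simp only [nodeLo, List.length_cons]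
  rcases two_pow_sub_half D w.length with ⟨-, h1, h2⟩ | ⟨-, h1, h2, h3⟩ <;> cases b <;> simp <;>
    omega

theorem lt_nodeHi_cons {b : Bool} {w : List Bool} (h : m < nodeLo D w + 2 ^ (D - w.length))
    (hb : nodeLo D w + 2 ^ (D - w.length) / 2 ≤ m → b = true) :
    m < nodeLo D (b :: w) + 2 ^ (D - (b :: w).length) := by
  simp only [nodeLo, List.length_cons]
  rcases two_pow_sub_half D w.length with ⟨-, h1, h2⟩ | ⟨-, h1, h2, h3⟩ <;> cases b <;>
    simp at hb ⊢ <;> omega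

theorem onPath_cons {b : Bool} {w : List Bool} (h : OnPath D m w)
    (hb : nodeLo D w + 2 ^ (D - w.length) / 2 ≤ m ↔ b = true) : OnPath D m (b :: w) := by
  refine ⟨?_, lt_nodeHi_cons h.2 hb.1⟩
  have := h.1
  cases b
  · simpa [nodeLo] using this
  · simpa [nodeLo] using hb.2 rfl

/-- The right end moves left only on a "no", which is never wrong. Hence checking the left end is
enough to detect that the walk left the path to m. -/
theorem lt_nodeHi_searchWalk {h : List Bool} (hm : m < 2 ^ D)
    (ht : TruthfulNo (searchIndex D) m h) :
    m < nodeLo D (searchWalk h).1 + 2 ^ (D - (searchWalk h).1.length) := by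
  induction h with
  | nil => simpa [searchWalk, nodeLo] using hm
  | cons a h ih =>
    obtain ⟨h1, h2⟩ := ht
    have ih := ih h1
    rw [searchIndex] at h2
    rw [searchWalk]
    rcases hs : searchWalk h with ⟨w, p⟩
    rw [hs] at ih h2
    cases p
    · cases a
      · simp only [Bool.false_eq_true, if_false]
        cases w with
        | nil => exact ih
        | cons b w => exact ih.trans_le (nodeHi_cons_le b w)
      · simpa using ih
    · simp only [if_true] at h2 ⊢
      exact lt_nodeHi_cons ih h2

/-- A correct answer raises the potential by at least 1 and a false "yes" lowers it by at most 3 = 4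
- 1. -/
theorem potential_searchWalk {h : List Bool} (hm : m < 2 ^ D)
    (ht : TruthfulNo (searchIndex D) m h) :
    (h.length : ℤ) - 4 * falseYes (searchIndex D) m h ≤ potential D m (searchWalk h) := by
  induction h with
  | nil => simp [falseYes, potential, searchWalk, progress]
  | cons a h ih =>
    obtain ⟨h1, h2⟩ := ht
    have ih := ih h1
    have hi := lt_nodeHi_searchWalk hm h1
    rw [falseYes, searchWalk]
    rw [searchIndex] at h2 ⊢
    rcases hs : searchWalk h with ⟨w, p⟩
    rw [hs] at ih hi h2
    simp only at hi h2
    simp only [List.length_cons]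
    cases p
    · simp only [Bool.false_eq_true, if_false, add_zero] at h2 ⊢
      cases a
      -- A truthful "no" shows that the node is off the path, so backtracking gains 2. It cannot
      -- occur at the root, whose left end is 0.
      · simp only [Bool.false_eq_true, imp_false, not_le, false_and, if_false, add_zero] at h2 ⊢
        cases w with
        | nil => simp [nodeLo] at h2
        | cons b w =>
          have hn : ¬ OnPath D m (b :: w) := fun h => absurd h.1 (by omega)
          simp only [potential, Bool.false_eq_true, if_false, progress, hn, List.tail_cons] at ih ⊢
          push_cast
          omega
      · by_cases hp : OnPath D m w
        · have hlo : ¬ m < nodeLo D w := by have := hp.1; omega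
          simp only [potential, Bool.false_eq_true, if_false, if_true, hp, hlo, and_false] at ih ⊢
          push_cast
          omega
        · have hlo : m < nodeLo D w := by
            by_contra! hle
            exact hp ⟨hle, hi⟩
          simp only [potential, Bool.false_eq_true, if_false, if_true, hp, hlo, and_true] at ih ⊢
          push_cast
          omega
    · simp only [if_true] at h2 ⊢
      have hge := progress_sub_one_le (D := D) (m := m) a w
      by_cases hp : OnPath D m w
      · have hpl := progress_eq_length hp
        by_cases hb : a = true ∧ m < nodeLo D w + 2 ^ (D - w.length) / 2
        · simp only [potential, Bool.false_eq_true, if_false, if_true, hp, hb, and_self] at ih ⊢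
          simp only [hb.1] at hge
          push_cast
          omega
        · have hp' : OnPath D m (a :: w) := by
            refine onPath_cons hp ⟨h2, fun ha => ?_⟩
            by_contra! hlt
            exact hb ⟨ha, hlt⟩
          have hpl' := progress_eq_length hp'
          simp only [List.length_cons] at hpl'
          simp only [potential, Bool.false_eq_true, if_false, if_true, hp, hb] at ih ⊢
          push_cast at hpl' ⊢
          omega
      -- Off the path the answer to the probe is irrelevant: progress drops by at most 1, and 2p - 3
      -- becomes at least 2p - 2.
      · simp only [potential, Bool.false_eq_true, if_false, if_true, hp] at ih ⊢
        push_cast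
        split <;> omega

/-- The deepest ancestor on the path then has depth at least D. Its interval is {m}, and steps below
depth D do not move the left end. -/
theorem nodeLo_eq_of_le_progress {w : List Bool} (h : (D : ℤ) ≤ progress D m w) (hm : m < 2 ^ D) :
    nodeLo D w = m := by
  induction w with
  | nil =>
    simp only [progress] at h
    have : D = 0 := by omega
    subst this
    simp only [nodeLo]
    omega
  | cons b w ih =>
    by_cases hp : OnPath D m (b :: w)
    · rw [progress_eq_length hp] at h
      have h0 : D - (b :: w).length = 0 := by omega
      have h1 := hp.1
      have h2 := hp.2
      rw [h0] at h2
      omega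
    · simp only [progress, hp, if_false] at h
      have hl := progress_le_length (D := D) (m := m) w
      have h0 : D - w.length = 0 := by omega
      rw [nodeLo, ih (by omega), h0]
      simp

/-- The search finds `m` if at most one eighth of the answers are wrong. -/
theorem searchResult_eq {h : List Bool} (hm : m < 2 ^ D) (hl : h.length = 4 * D)
    (ht : TruthfulNo (searchIndex D) m h) (hf : 2 * falseYes (searchIndex D) m h ≤ D) :
    searchResult D h = m := by
  have hpot := potential_searchWalk hm ht
  refine nodeLo_eq_of_le_progress ?_ hm
  rw [hl, potential] at hpot
  push_cast at hpot
  split at hpot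
  · split at hpot <;> omega
  · omega

end Search

/-! ### Building protocols from finite interactions -/

section Interaction

universe u

/-- The input type of a player. -/
abbrev PlayerInput (X Y : Type u) : Player → Type u
  | .alice => X
  | .bob => Y

/-- The input of a player. -/
def playerInput {X Y : Type u} (x : X) (y : Y) : (p : Player) → PlayerInput X Y p
  | .alice => x
  | .bob => y

/-- Finite interactions of the two players with a common result: binary trees whose inner nodes
are labelled by the sender of the next bit and the rule for this bit. -/
inductive Interaction (X Y : Type u) (Z : Type) : Type u
  | ret (z : Z)
  | send (p : Player) (f : PlayerInput X Y p → Coins → Bool) (hf : ∀ x, Measurable (f x))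
      (next : Bool → Interaction X Y Z)

namespace Interaction

variable {X Y : Type u} {Z Z' L : Type}

/-- Sequential composition. -/
def bind : Interaction X Y Z → (Z → Interaction X Y Z') → Interaction X Y Z'
  | ret z, g => g z
  | send p f hf next, g => send p f hf fun b => (next b).bind g

/-- The result of an interaction. -/
def result (x : X) (y : Y) (ω : Coins) : Interaction X Y Z → Z
  | ret z => z
  | send p f _ next => (next (f (playerInput x y p) ω)).result x y ω

/-- The bits sent in an interaction, most recent bit first. -/
def trace (x : X) (y : Y) (ω : Coins) : Interaction X Y Z → Transcript
  | ret _ => []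
  | send p f _ next =>
    (next (f (playerInput x y p) ω)).trace x y ω ++ [(p, f (playerInput x y p) ω)]

variable (x : X) (y : Y) (ω : Coins)

@[simp]
theorem result_ret (z : Z) : (ret z : Interaction X Y Z).result x y ω = z := rfl

@[simp]
theorem trace_ret (z : Z) : (ret z : Interaction X Y Z).trace x y ω = [] := rfl

@[simp]
theorem result_bind (P : Interaction X Y Z) (g : Z → Interaction X Y Z') :
    (P.bind g).result x y ω = (g (P.result x y ω)).result x y ω := by
  induction P with
  | ret z => rfl
  | send p f hf next ih => simp only [bind, result, ih]

@[simp]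
theorem trace_bind (P : Interaction X Y Z) (g : Z → Interaction X Y Z') :
    (P.bind g).trace x y ω = (g (P.result x y ω)).trace x y ω ++ P.trace x y ω := by
  induction P with
  | ret z => simp [bind, result, trace]
  | send p f hf next ih => simp only [bind, result, trace, ih, List.append_assoc]

/-- Replace the request to continue with the interaction `body l` by this interaction. -/
def unfold (body : L → Interaction X Y (Z ⊕ L)) :
    Interaction X Y (Z ⊕ L) → Interaction X Y (Z ⊕ L)
  | ret (.inr l) => body l
  | P => P

/-- What remains of an interaction after the next bit. -/
def advance (b : Bool) : Interaction X Y Z → Interaction X Y Z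
  | send _ _ _ next => next b
  | ret z => ret z

/-- The player who sends the next bit. -/
def sender : Interaction X Y Z → Option Player
  | send p _ _ _ => some p
  | ret _ => none

/-- The next bit of Alice. -/
def aliceBit (x : X) (ω : Coins) : Interaction X Y Z → Bool
  | send .alice f _ _ => f x ω
  | _ => false

/-- The next bit of Bob. -/
def bobBit (y : Y) (ω : Coins) : Interaction X Y Z → Bool
  | send .bob f _ _ => f y ω
  | _ => false

/-- The output at the end of a loop. -/
def loopOutput [Inhabited Z] : Interaction X Y (Z ⊕ L) → Z
  | ret (.inl z) => z
  | _ => default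

theorem measurable_aliceBit (x : X) (P : Interaction X Y Z) :
    Measurable fun ω => P.aliceBit x ω := by
  cases P with
  | ret z => exact measurable_const
  | send p f hf next =>
    cases p
    · exact hf x
    · exact measurable_const

theorem measurable_bobBit (y : Y) (P : Interaction X Y Z) :
    Measurable fun ω => P.bobBit y ω := by
  cases P with
  | ret z => exact measurable_const
  | send p f hf next =>
    cases p
    · exact measurable_const
    · exact hf y

/-- The interaction that remains after some bits when the interactions `body l` are performed in a
loop. -/
def loopState (body : L → Interaction X Y (Z ⊕ L)) (l₀ : L) :
    Transcript → Interaction X Y (Z ⊕ L)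
  | [] => body l₀
  | q :: h => unfold body ((loopState body l₀ h).advance q.2)

/-- The protocol that performs the interactions `body l` in a loop, where the result of each of
them is the output or the label of the next one. -/
def loop [Inhabited Z] (body : L → Interaction X Y (Z ⊕ L)) (l₀ : L) :
    PublicCoinProtocol X Y Z where
  next _ h := (loopState body l₀ h).sender
  aliceBit x ω h := (loopState body l₀ h).aliceBit x ω
  bobBit y ω h := (loopState body l₀ h).bobBit y ω
  output _ h := (loopState body l₀ h).loopOutput
  measurableSet_next _ _ := MeasurableSet.const _
  measurableSet_aliceBit x h b :=
    (measurable_aliceBit x (loopState body l₀ h)) (measurableSet_singleton b)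
  measurableSet_bobBit y h b :=
    (measurable_bobBit y (loopState body l₀ h)) (measurableSet_singleton b)
  measurableSet_output _ _ := MeasurableSet.const _

variable [Inhabited Z] {x y ω}

/-- The loop simulates `P` bit by bit. The invariant has `unfold body` because a finished `P` may be
a request for the next body, which the loop performs without sending a bit. -/
theorem reaches_loop_trace {body : L → Interaction X Y (Z ⊕ L)} {l₀ : L}
    (P : Interaction X Y (Z ⊕ L)) {h : Transcript}
    (hr : (loop body l₀).Reaches x y ω h) (hs : loopState body l₀ h = unfold body P) :
    (loop body l₀).Reaches x y ω (P.trace x y ω ++ h) ∧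
      loopState body l₀ (P.trace x y ω ++ h) = unfold body (ret (P.result x y ω)) := by
  induction P generalizing h with
  | ret z => exact ⟨hr, hs⟩
  | send p f hf next ih =>
    have hs' : loopState body l₀ h = send p f hf next := hs
    have hr' : (loop body l₀).Reaches x y ω ((p, f (playerInput x y p) ω) :: h) := by
      have hn : (loop body l₀).next ω h = some p := by simp only [loop, hs', sender]
      cases p
      · have hb : (loop body l₀).aliceBit x ω h = f (playerInput x y .alice) ω := by
          simp only [loop, hs']
          rfl
        exact hb ▸ PublicCoinProtocol.Reaches.alice h hr hn
      · have hb : (loop body l₀).bobBit y ω h = f (playerInput x y .bob) ω := by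
          simp only [loop, hs']
          rfl
        exact hb ▸ PublicCoinProtocol.Reaches.bob h hr hn
    have := ih (f (playerInput x y p) ω) hr' (by simp only [loopState, hs', advance])
    simpa only [trace, result, List.append_assoc, List.singleton_append] using this

/-- A loop over the natural numbers in which the first `s` interactions ask for the next one and
interaction number `s` ends the loop. -/
theorem stopsWith_loop {body : ℕ → Interaction X Y (Z ⊕ ℕ)}
    (hbody : ∀ l, unfold body (body l) = body l) {s : ℕ} {z : Z}
    (hlt : ∀ i < s, (body i).result x y ω = .inr (i + 1))
    (hs : (body s).result x y ω = .inl z) :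
    ∃ h, (loop body 0).StopsWith x y ω h ∧ (loop body 0).output ω h = z ∧
      h = (((List.range (s + 1)).map fun i => (body i).trace x y ω).reverse).flatten := by
  have key : ∀ i ≤ s, ∃ h, (loop body 0).Reaches x y ω h ∧ loopState body 0 h = body i ∧
      h = (((List.range i).map fun i => (body i).trace x y ω).reverse).flatten := by
    intro i hi
    induction i with
    | zero => exact ⟨[], .start, rfl, rfl⟩
    | succ i ih =>
      obtain ⟨h, h1, h2, h3⟩ := ih (by omega)
      obtain ⟨h4, h5⟩ := reaches_loop_trace (body i) h1 (h2.trans (hbody i).symm)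
      refine ⟨_, h4, h5.trans ?_, ?_⟩
      · rw [hlt i (by omega)]
        rfl
      · rw [List.range_succ]
        simp [h3]
  obtain ⟨h, h1, h2, h3⟩ := key s le_rfl
  obtain ⟨h4, h5⟩ := reaches_loop_trace (body s) h1 (h2.trans (hbody s).symm)
  rw [hs] at h5
  refine ⟨_, ⟨h4, ?_⟩, ?_, ?_⟩
  · simp only [loop, h5, unfold, sender]
  · simp only [loop, h5, unfold, loopOutput]
  · rw [List.range_succ]
    simp [h3]

end Interaction

end Interaction

/-! ### Rounds -/

theorem rounds_append_le (t₁ t₂ : Transcript) :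
    Transcript.rounds (t₁ ++ t₂) ≤ Transcript.rounds t₁ + Transcript.rounds t₂ := by
  induction t₁ with
  | nil => simp [Transcript.rounds]
  | cons a t ih =>
    cases t with
    | nil =>
      cases t₂ with
      | nil => simp [Transcript.rounds]
      | cons b t₂ =>
        simp only [List.singleton_append, Transcript.rounds]
        split <;> omega
    | cons b t =>
      simp only [List.cons_append, Transcript.rounds] at ih ⊢
      omega

theorem rounds_le_one {p : Player} {t : Transcript} (h : ∀ q ∈ t, q.1 = p) :
    Transcript.rounds t ≤ 1 := by
  induction t with
  | nil => simp [Transcript.rounds]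
  | cons a t ih =>
    cases t with
    | nil => simp [Transcript.rounds]
    | cons b t =>
      have ha := h a (by simp)
      have hb := h b (by simp)
      have := ih fun q hq => h q (by simp [hq])
      simp only [Transcript.rounds, ha, hb, if_true] at this ⊢
      omega

/-! ### Random hashing with public coins -/

theorem coinMeasure_box_le {ι : Type*} [Fintype ι] {w : ι → ℕ} (hw : Function.Injective w)
    (c : ι → Bool) : coinMeasure {ω | ∀ i, ω (w i) = c i} ≤ 2⁻¹ ^ Fintype.card ι := by
  classical
  have hset : {ω : Coins | ∀ i, ω (w i) = c i} =
      Set.pi (Finset.univ.image w) fun n => {Function.extend w c (fun _ => false) n} := by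
    ext ω
    simp [Set.mem_pi, hw.extend_apply]
  rw [hset, coinMeasure, Measure.infinitePi_pi _ (fun i _ => measurableSet_singleton _)]
  rw [Finset.prod_congr rfl (g := fun _ => (2⁻¹ : ENNReal)), Finset.prod_const,
    Finset.card_image_of_injective _ hw, Finset.card_univ]
  intro n _
  rw [PMF.toMeasure_apply_singleton _ _ (measurableSet_singleton _)]
  simp

/-- Coordinates of a coin sequence agree in prescribed disjoint pairs. -/
theorem coinMeasure_pairs_le {ι : Type*} [Fintype ι] {u v : ι → ℕ} (hu : Function.Injective u)
    (hv : Function.Injective v) (huv : ∀ a b, u a ≠ v b) :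
    coinMeasure {ω | ∀ i, ω (u i) = ω (v i)} ≤ 2⁻¹ ^ Fintype.card ι := by
  classical
  -- Split by the common values c: there are 2^n choices, each fixing 2n distinct coins.
  have hsub : {ω : Coins | ∀ i, ω (u i) = ω (v i)} ⊆
      ⋃ c : ι → Bool, {ω | ∀ i, ω (Sum.elim u v i) = Sum.elim c c i} := by
    intro ω hω
    simp only [Set.mem_iUnion, Set.mem_ofPred_eq] at hω ⊢
    refine ⟨fun i => ω (u i), ?_⟩
    rintro (i | i)
    · rfl
    · exact (hω i).symm
  have hw : Function.Injective (Sum.elim u v) := hu.sumElim hv huv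
  calc _ ≤ _ := measure_mono hsub
    _ ≤ ∑ c : ι → Bool, coinMeasure {ω | ∀ i, ω (Sum.elim u v i) = Sum.elim c c i} :=
      measure_iUnion_fintype_le _ _
    _ ≤ ∑ c : ι → Bool, 2⁻¹ ^ Fintype.card (ι ⊕ ι) :=
      Finset.sum_le_sum fun c _ => coinMeasure_box_le hw _
    _ = _ := by
      rw [Finset.sum_const, Finset.card_univ, Fintype.card_fun, Fintype.card_bool,
        Fintype.card_sum, nsmul_eq_mul, pow_add, ← mul_assoc]
      push_cast
      rw [← mul_pow, ENNReal.mul_inv_cancel (by simp) (by simp), one_pow, one_mul]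

section Hash

variable {Q O : Type*} (e : Q × ℕ × O → ℕ)

/-- The `b` bits by which the object `o` is hashed for the query `q`. -/
def hashBits (ω : Coins) (q : Q) (o : O) : ℕ → List Bool
  | 0 => []
  | b + 1 => ω (e (q, b, o)) :: hashBits ω q o b

variable {e}

theorem hashBits_eq_iff {ω : Coins} {q : Q} {o o' : O} {b : ℕ} :
    hashBits e ω q o b = hashBits e ω q o' b ↔ ∀ r : Fin b, ω (e (q, r, o)) = ω (e (q, r, o')) := by
  induction b with
  | zero => simp [hashBits]
  | succ b ih =>
    rw [hashBits, hashBits, List.cons.injEq, ih, Fin.forall_fin_succ', and_comm]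
    simp

theorem measurableSet_hashBits_eq (q : Q) (o : O) (b : ℕ) (c : List Bool) :
    MeasurableSet {ω | hashBits e ω q o b = c} := by
  induction b generalizing c with
  | zero => exact MeasurableSet.const ([] = c)
  | succ b ih =>
    cases c with
    | nil => simp [hashBits]
    | cons a c =>
      simp only [hashBits, List.cons.injEq, Set.ofPred_and]
      exact (measurable_pi_apply (e (q, b, o)) (measurableSet_singleton a)).inter (ih c)

/-- For all queries of a set, one of `k` objects collides with another one. -/
theorem coinMeasure_collisions_le (he : Function.Injective e) {k b : ℕ} (S : Finset Q) (o : Q → O)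
    (o' : Q → Fin k → O) :
    coinMeasure {ω | ∀ q ∈ S, ∃ j, o' q j ≠ o q ∧
      hashBits e ω q (o' q j) b = hashBits e ω q (o q) b} ≤ (k * 2⁻¹ ^ b) ^ S.card := by
  classical
  -- Union bound over the choice, for each query, of the colliding object; the k ^ |S| choices
  -- account for the factor k per query.
  have hsub : {ω | ∀ q ∈ S, ∃ j, o' q j ≠ o q ∧
      hashBits e ω q (o' q j) b = hashBits e ω q (o q) b} ⊆
      ⋃ J : S → Fin k, {ω | ∀ q : S, o' q (J q) ≠ o q ∧
        hashBits e ω q (o' q (J q)) b = hashBits e ω q (o q) b} := by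
    intro ω hω
    choose J hJ using fun q : S => hω q q.2
    exact Set.mem_iUnion.2 ⟨J, hJ⟩
  have hone : ∀ J : S → Fin k, coinMeasure {ω | ∀ q : S, o' q (J q) ≠ o q ∧
      hashBits e ω q (o' q (J q)) b = hashBits e ω q (o q) b} ≤ (2⁻¹ ^ b) ^ S.card := by
    intro J
    by_cases hJ : ∀ q : S, o' q (J q) ≠ o q
    · have := coinMeasure_pairs_le (ι := S × Fin b)
        (u := fun i => e (i.1, i.2, o' i.1 (J i.1))) (v := fun i => e (i.1, i.2, o i.1))
        (fun i i' h => by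
          have := he h
          simp only [Prod.mk.injEq] at this
          exact Prod.ext (Subtype.ext this.1) (Fin.ext this.2.1))
        (fun i i' h => by
          have := he h
          simp only [Prod.mk.injEq] at this
          exact Prod.ext (Subtype.ext this.1) (Fin.ext this.2.1))
        (fun i i' h => by
          have := he h
          simp only [Prod.mk.injEq] at this
          obtain ⟨h1, -, h3⟩ := this
          have h1 : i.1 = i'.1 := Subtype.ext h1
          rw [← h1] at h3
          exact hJ _ h3)
      rw [Fintype.card_prod, Fintype.card_coe, Fintype.card_fin, mul_comm, pow_mul] at this
      refine (measure_mono ?_).trans this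
      intro ω hω i
      exact hashBits_eq_iff.1 (hω i.1).2 i.2
    · have : {ω | ∀ q : S, o' q (J q) ≠ o q ∧
          hashBits e ω q (o' q (J q)) b = hashBits e ω q (o q) b} = ∅ := by
        ext ω
        simp only [Set.mem_ofPred_eq, Set.mem_empty_iff_false, iff_false]
        exact fun h => hJ fun q => (h q).1
      rw [this, measure_empty]
      exact zero_le
  calc _ ≤ _ := measure_mono hsub
    _ ≤ _ := measure_iUnion_fintype_le _ _
    _ ≤ ∑ J : S → Fin k, (2⁻¹ ^ b) ^ S.card := Finset.sum_le_sum fun J _ => hone J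
    _ = _ := by
      rw [Finset.sum_const, Finset.card_univ, Fintype.card_fun, Fintype.card_fin,
        Fintype.card_coe, nsmul_eq_mul, mul_pow]
      push_cast
      rfl

end Hash

/-! ### Common phrases -/

section CommonPhrases

variable {σ : Type*} [DecidableEq σ] {k : ℕ}

/-- One of the strings `B j` has the same first `i` phrases as `A`. -/
def SharesPhrases (A : List σ) (B : Fin k → List σ) (i : ℕ) : Prop :=
  ∃ j, i ≤ (lz77 (B j)).length ∧ (lz77 (B j)).take i = (lz77 A).take i

variable {A : List σ} {B : Fin k → List σ} {m : ℕ}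

theorem SharesPhrases.mono {i i' : ℕ} (h : SharesPhrases A B i) (hi : i' ≤ i) :
    SharesPhrases A B i' := by
  obtain ⟨j, h1, h2⟩ := h
  refine ⟨j, hi.trans h1, ?_⟩
  have := congrArg (List.take i') h2
  rwa [List.take_take, List.take_take, min_eq_left hi] at this

/-- The property is monotone and holds at 0. It is bounded because `i` phrases must really exist in
`B j`; equality of `take i` alone would hold for all `i` if `B j = A`. -/
theorem exists_forall_sharesPhrases_iff (hk : 1 ≤ k) (A : List σ) (B : Fin k → List σ) :
    ∃ m, ∀ i, SharesPhrases A B i ↔ i ≤ m := by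
  classical
  set N := Finset.univ.sup fun j => (lz77 (B j)).length
  have hN : ∀ i, SharesPhrases A B i → i ≤ N := fun i ⟨j, h, _⟩ =>
    h.trans (Finset.le_sup (f := fun j => (lz77 (B j)).length) (Finset.mem_univ j))
  refine ⟨Nat.findGreatest (SharesPhrases A B) N, fun i => ⟨fun h => ?_, fun h => ?_⟩⟩
  · exact Nat.le_findGreatest (hN i h) h
  · exact (Nat.findGreatest_spec (P := SharesPhrases A B) (Nat.zero_le N)
      ⟨⟨0, hk⟩, by simp, by simp⟩).mono h

/-- The text of the first `m` phrases. -/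
def phrasesText (A : List σ) (m : ℕ) : List σ := ((lz77 A).take m).flatten

theorem phrasesText_prefix (A : List σ) (m : ℕ) : phrasesText A m <+: A :=
  (lz77From_eq_take_append m [] A).2

theorem lz77_eq_take_append (A : List σ) (m : ℕ) :
    lz77 A = (lz77 A).take m ++
      lz77From (phrasesText A m) (A.drop (phrasesText A m).length) := by
  simpa [lz77, phrasesText] using (lz77From_eq_take_append m [] A).1

theorem length_phrasesText_lt (A : List σ) (m : ℕ) : (phrasesText A m).length < 2 ^ m := by
  have := length_flatten_take_lz77From m [] A
  simp only [List.length_nil] at this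
  rw [phrasesText, lz77]
  omega

theorem length_phrasesText_le_maxLcp (h : SharesPhrases A B m) :
    (phrasesText A m).length ≤ maxLcp A B := by
  obtain ⟨j, -, h⟩ := h
  refine le_trans (length_le_lcp (phrasesText_prefix A m) ?_) (lcp_le_maxLcp A B j)
  rw [phrasesText, ← h]
  exact phrasesText_prefix (B j) m

/-- This is m ≤ z: the shared phrases lie in A[1,ℓ], and truncating A there does not change them. -/
theorem le_length_lz77_take_maxLcp (h : SharesPhrases A B m) :
    m ≤ (lz77 (A.take (maxLcp A B))).length := by
  have hle := length_phrasesText_le_maxLcp h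
  have hm : ((lz77 A).take m).length = m := by
    obtain ⟨j, h1, h2⟩ := h
    rw [← h2, List.length_take, min_eq_left h1]
  have hpre := phrasesText_prefix A m
  rcases hpre.length_le.lt_or_eq with hlt | heq
  · have := take_lz77From_eq_of_prefix m [] (s := A) (t := A.take (maxLcp A B)) hlt ?_
    · change (lz77 (A.take (maxLcp A B))).take m = (lz77 A).take m at this
      rw [← this, List.length_take] at hm
      omega
    · exact List.prefix_take_iff.2 ⟨hpre, hle⟩
  -- If the phrases exhaust A, the last one may lack its extra symbol, but then ℓ = |A| and nothing
  -- is truncated.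
  · rw [List.take_of_length_le (heq ▸ hle)]
    rw [List.length_take] at hm
    omega

/-- The part of phrase number `m` (counted from zero) that is copied, given the text before it. -/
def copyLenAt (A : List σ) (m : ℕ) : ℕ :=
  copyLen (phrasesText A m) (A.drop (phrasesText A m).length)

/-- Otherwise a `B j` attaining ℓ contains the whole next phrase of A with its extra symbol, and
greedy parsing produces that phrase in `B j` as well. -/
theorem maxLcp_le_of_not_sharesPhrases (hk : 1 ≤ k)
    (h' : ¬ SharesPhrases A B (m + 1)) (h : SharesPhrases A B m) :
    maxLcp A B ≤ (phrasesText A m).length + copyLenAt A m := by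
  by_contra! hlt
  have hpre := phrasesText_prefix A m
  have hlenA := maxLcp_le_length A B
  have hm : ((lz77 A).take m).length = m := by
    obtain ⟨j, h1, h2⟩ := h
    rw [← h2, List.length_take, min_eq_left h1]
  obtain ⟨j, hj⟩ := exists_lcp_eq_maxLcp hk A B
  have hAB : A.take ((phrasesText A m).length + copyLenAt A m + 1) <+: B j :=
    take_prefix_of_le_lcp (by omega)
  have hPB : phrasesText A m <+: B j := by
    rw [List.prefix_iff_eq_take.1 hpre]
    exact (List.take_prefix_take_left (by omega)).trans hAB
  have htake : (lz77 (B j)).take m = (lz77 A).take m :=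
    take_lz77From_eq_of_prefix m [] (s := A) (t := B j)
      (show (phrasesText A m).length < A.length by omega) hPB
  have htext : phrasesText (B j) m = phrasesText A m := by rw [phrasesText, htake, phrasesText]
  have hA := lz77_eq_take_append A m
  have hB := lz77_eq_take_append (B j) m
  rw [htext, htake] at hB
  set P := phrasesText A m
  set R := A.drop P.length with hR
  set R' := B j |>.drop P.length with hR'
  change P.length + copyLen P R < _ at hlt
  change A.take (P.length + copyLen P R + 1) <+: B j at hAB
  have hAR : A = P ++ R := by
    conv_lhs => rw [← List.take_append_drop P.length A, ← List.prefix_iff_eq_take.1 hpre]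
  have hBR : B j = P ++ R' := by
    conv_lhs => rw [← List.take_append_drop P.length (B j), ← List.prefix_iff_eq_take.1 hPB]
  have hRlen : copyLen P R < R.length := by
    have hRA : R.length = A.length - P.length := by rw [hR, List.length_drop]
    omega
  have hRR : R.take (copyLen P R + 1) <+: R' := by
    rw [hAR, hBR, add_assoc, List.take_length_add_append] at hAB
    exact (List.prefix_append_right_inj _).1 hAB
  have hc := copyLen_eq_of_take_prefix hRlen hRR
  have hRne : R ≠ [] := by rintro h0; simp [h0] at hRlen
  have hR'ne : R' ≠ [] := by
    rintro h0
    have := hRR.length_le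
    rw [h0, List.length_take, List.length_nil] at this
    omega
  have hphrase : R'.take (copyLen P R + 1) = R.take (copyLen P R + 1) := by
    have hlen : (R.take (copyLen P R + 1)).length = copyLen P R + 1 := by
      rw [List.length_take]; omega
    conv_lhs => rw [← hlen]
    exact (List.prefix_iff_eq_take.1 hRR).symm
  refine h' ⟨j, ?_, ?_⟩
  all_goals generalize (lz77 A).take m = M at *
  · rw [hB, lz77From_eq_cons P hR'ne, List.length_append, hm, List.length_cons]
    omega
  · rw [hB, hA, lz77From_eq_cons P hR'ne, lz77From_eq_cons P hRne, hc, hphrase]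
    rw [List.take_append, List.take_append]
    simp only [hm, Nat.add_sub_cancel_left, List.take_succ_cons, List.take_zero]

/-- The source position and the length of the copied part of phrase number `m` (counted from
zero), as one number. -/
noncomputable def phraseCode (A : List σ) (m : ℕ) : ℕ :=
  Nat.pair (exists_source (phrasesText A m) (A.drop (phrasesText A m).length)).choose
    (copyLenAt A m)

/-- The copy of the part of `P` that is described by `n`, appended to `P`. -/
def extendByCode (P : List σ) (n : ℕ) : List σ := P ++ (P.drop n.unpair.1).take n.unpair.2

theorem extendByCode_phraseCode (A : List σ) (m : ℕ) :
    extendByCode (phrasesText A m) (phraseCode A m) =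
      A.take ((phrasesText A m).length + copyLenAt A m) := by
  have h := (exists_source (phrasesText A m)
    (A.drop (phrasesText A m).length)).choose_spec.2
  have hpre := phrasesText_prefix A m
  rw [extendByCode, phraseCode, Nat.unpair_pair]
  simp only [copyLenAt] at h ⊢
  rw [h, List.take_add, ← List.prefix_iff_eq_take.1 hpre]

theorem maxLcp_extendByCode (hk : 1 ≤ k) (h : SharesPhrases A B m)
    (h' : ¬ SharesPhrases A B (m + 1)) :
    maxLcp (extendByCode (phrasesText A m) (phraseCode A m)) B = maxLcp A B := by
  rw [extendByCode_phraseCode, maxLcp_take,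
    min_eq_right (maxLcp_le_of_not_sharesPhrases hk h' h)]

/-- Source and length are both at most the length of the shared text, hence at most ℓ when m phrases
are shared, so the code has O(lg ℓ) bits. -/
theorem phraseCode_lt (A : List σ) (m : ℕ) :
    phraseCode A m < ((phrasesText A m).length + 1) ^ 2 := by
  have h := (exists_source (phrasesText A m)
    (A.drop (phrasesText A m).length)).choose_spec.1
  have hc : copyLenAt A m ≤ (phrasesText A m).length := copyLen_le_length_past _ _
  refine (Nat.pair_lt_max_add_one_sq _ _).trans_le ?_
  gcongr
  exact max_le h hc

/-- Phrases at most double the text, so both players know a cap on the code from m alone; the cap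
keeps the interaction finite even after an error. -/
theorem phraseCode_lt_two_pow (A : List σ) (m : ℕ) : phraseCode A m < 2 ^ (2 * m + 2) := by
  refine (phraseCode_lt A m).trans_le ?_
  have := length_phrasesText_lt A m
  calc _ ≤ (2 ^ m) ^ 2 := by gcongr; omega
    _ = 2 ^ (2 * m) := by rw [← pow_mul, mul_comm]
    _ ≤ _ := Nat.pow_le_pow_right (by norm_num) (by omega)

theorem maxLcp_lt_two_pow (hk : 1 ≤ k) (h : SharesPhrases A B m)
    (h' : ¬ SharesPhrases A B (m + 1)) : maxLcp A B < 2 ^ (2 * m + 2) := by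
  have h1 := maxLcp_le_of_not_sharesPhrases hk h' h
  have h2 := length_phrasesText_lt A m
  have hc : copyLenAt A m ≤ (phrasesText A m).length := copyLen_le_length_past _ _
  calc maxLcp A B < 2 * 2 ^ m := by omega
    _ = 2 ^ (m + 1) := by ring
    _ ≤ _ := Nat.pow_le_pow_right (by norm_num) (by omega)

end CommonPhrases

/-! ### Sending numbers -/

namespace Interaction

universe u

variable {X Y : Type u}

/-- One player sends a number bit by bit, where each bit is preceded by a bit that tells whether
the rest of the number is nonzero. At most `n` bits of the number are sent. -/
def sendNat (p : Player) : (n : ℕ) → (f : PlayerInput X Y p → Coins → ℕ) →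
    (∀ x, Measurable (f x)) → Interaction X Y ℕ
  | 0, _, _ => ret 0
  | n + 1, f, hf =>
    send p (fun x ω => decide (f x ω ≠ 0))
      (fun x => (Measurable.of_discrete (f := fun v : ℕ => decide (v ≠ 0))).comp (hf x))
      fun a =>
        if a then
          send p (fun x ω => decide (f x ω % 2 = 1))
            (fun x => (Measurable.of_discrete (f := fun v : ℕ => decide (v % 2 = 1))).comp (hf x))
            fun b =>
              (sendNat p n (fun x ω => f x ω / 2)
                (fun x => (Measurable.of_discrete (f := fun v : ℕ => v / 2)).comp (hf x))).bind
                fun v => ret (2 * v + if b then 1 else 0)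
        else ret 0

variable {x : X} {y : Y} {ω : Coins} {p : Player}

theorem result_sendNat {n : ℕ} {f : PlayerInput X Y p → Coins → ℕ} (hf : ∀ x, Measurable (f x))
    (h : f (playerInput x y p) ω < 2 ^ n) :
    (sendNat p n f hf).result x y ω = f (playerInput x y p) ω := by
  induction n generalizing f with
  | zero =>
    simp only [sendNat, result]
    omega
  | succ n ih =>
    rw [sendNat]
    simp only [result]
    rcases eq_or_ne (f (playerInput x y p) ω) 0 with h0 | h0
    · simp [h0]
    · simp only [h0, ne_eq, not_false_eq_true, decide_true, if_true, result, result_bind]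
      rw [ih]
      · simp only [decide_eq_true_eq]
        split <;> omega
      · rw [pow_succ] at h
        omega

/-- The code is self-delimiting: its cost depends on the number sent, not on the cap `n`. -/
theorem length_trace_sendNat {n L : ℕ} {f : PlayerInput X Y p → Coins → ℕ}
    (hf : ∀ x, Measurable (f x)) (h : f (playerInput x y p) ω < 2 ^ L) :
    ((sendNat p n f hf).trace x y ω).length ≤ 2 * L + 1 := by
  induction n generalizing f L with
  | zero => simp [sendNat]
  | succ n ih =>
    rw [sendNat]
    simp only [trace, List.length_append, List.length_singleton]
    rcases eq_or_ne (f (playerInput x y p) ω) 0 with h0 | h0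
    · simp [h0]
    · simp only [h0, ne_eq, not_false_eq_true, decide_true, if_true, trace, trace_bind,
        List.nil_append, List.length_append, List.length_singleton]
      cases L with
      | zero => simp at h; omega
      | succ L =>
        have := ih (L := L) (f := fun x ω => f x ω / 2) (fun x =>
          (Measurable.of_discrete (f := fun v : ℕ => v / 2)).comp (hf x)) (by
            rw [pow_succ] at h
            omega)
        omega

theorem fst_of_mem_trace_sendNat {n : ℕ} {f : PlayerInput X Y p → Coins → ℕ}
    (hf : ∀ x, Measurable (f x)) :
    ∀ q ∈ (sendNat p n f hf).trace x y ω, q.1 = p := by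
  induction n generalizing f with
  | zero => simp [sendNat]
  | succ n ih =>
    rw [sendNat]
    simp only [trace, List.mem_append, List.mem_singleton]
    rintro q (hq | rfl)
    · split at hq
      · simp only [trace, trace_bind, List.nil_append, List.mem_append,
          List.mem_singleton] at hq
        rcases hq with hq | rfl
        · exact ih _ q hq
        · rfl
      · simp at hq
    · rfl

end Interaction

/-! ### The protocol -/

section Protocol

open Interaction

universe u

variable {σ : Type u} [DecidableEq σ] {k : ℕ} (e : (ℕ × ℕ) × ℕ × List (List σ) → ℕ) (b : ℕ)

/-- Alice sends the hash of her first `i` phrases. -/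
def sendHash (q : ℕ × ℕ) (i : ℕ) :
    ℕ → Interaction (List σ) (Fin k → List σ) (List Bool)
  | 0 => ret []
  | b + 1 => send .alice (fun A ω => ω (e (q, b, (lz77 A).take i)))
      (fun _ => measurable_pi_apply _) fun a => (sendHash q i b).bind fun c => ret (a :: c)

/-- Which of the strings of Bob have at least `i` phrases and the hash `c` of the first `i`
phrases. -/
def hashMatches (q : ℕ × ℕ) (i : ℕ) (c : List Bool) (B : Fin k → List σ) (ω : Coins) :
    Fin k → Bool :=
  fun j => decide (i ≤ (lz77 (B j)).length ∧ hashBits e ω q ((lz77 (B j)).take i) b = c)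

theorem measurable_hashMatches (q : ℕ × ℕ) (i : ℕ) (c : List Bool) (B : Fin k → List σ) :
    Measurable (hashMatches e b q i c B) := by
  refine measurable_pi_iff.2 fun j => measurable_to_bool ?_
  have : (fun ω => hashMatches e b q i c B ω j) ⁻¹' {true} =
      {_ω | i ≤ (lz77 (B j)).length} ∩
        {ω | hashBits e ω q ((lz77 (B j)).take i) b = c} := by
    ext ω
    simp [hashMatches]
  rw [this]
  exact (MeasurableSet.const _).inter (measurableSet_hashBits_eq _ _ _ _)

/-- Bob learns the hash of the first `i` phrases of Alice and tells whether one of his strings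
matches. -/
def query (q : ℕ × ℕ) (i : ℕ) : Interaction (List σ) (Fin k → List σ) Bool :=
  (sendHash e q i b).bind fun c =>
    send .bob (fun B ω => decide (∃ j, hashMatches e b q i c B ω j))
      (fun B => (Measurable.of_discrete (f := fun v : Fin k → Bool => decide (∃ j, v j))).comp
        (measurable_hashMatches e b q i c B)) ret

/-- Perform `n` more queries of the binary search. -/
def search (D : ℕ) : ℕ → List Bool → Interaction (List σ) (Fin k → List σ) (List Bool)
  | 0, h => ret h
  | n + 1, h => (query e b (1, h.length) (searchIndex D h)).bind fun a => search D n (a :: h)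

/-- The answer of Bob if the first `m` phrases are common and phrase number `m` is encoded
by `n`. -/
def finalAnswer (m n : ℕ) (B : Fin k → List σ) (v : Fin k → Bool) : ℕ :=
  Finset.univ.sup fun j => if v j then maxLcp (extendByCode (phrasesText (B j) m) n) B else 0

/-- The end of the protocol, when `m` common phrases have been found. -/
noncomputable def finish (m : ℕ) : Interaction (List σ) (Fin k → List σ) ℕ :=
  (sendHash e (2, 0) m b).bind fun c =>
    (sendNat .alice (2 * m + 2) (fun A _ => phraseCode A m) fun _ => measurable_const).bind
      fun n =>
        sendNat .bob (2 * m + 2) (fun B ω => finalAnswer m n B (hashMatches e b (2, 0) m c B ω))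
          fun B => (Measurable.of_discrete (f := finalAnswer m n B)).comp
            (measurable_hashMatches e b (2, 0) m c B)

/-- Compare the first `2 ^ 2 ^ s` phrases. If they are not common, find the number of common
phrases by binary search. -/
noncomputable def stage (s : ℕ) : Interaction (List σ) (Fin k → List σ) (ℕ ⊕ ℕ) :=
  (query e b (0, s) (2 ^ 2 ^ s)).bind fun a =>
    if a then ret (.inr (s + 1))
    else (search e b (2 ^ s) (4 * 2 ^ s) []).bind fun h =>
      (finish e b (searchResult (2 ^ s) h)).bind fun z => ret (.inl z)

/-- Even with empty hashes Bob sends a bit, so a stage is never a bare request for another one. -/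
theorem unfold_stage (s : ℕ) :
    unfold (stage e b) (stage (k := k) e b s) = stage e b s := by
  cases b <;> rfl

/-! ### Results and costs of the pieces of the protocol -/

variable (A : List σ) (B : Fin k → List σ) (ω : Coins)

theorem result_sendHash (q : ℕ × ℕ) (i b : ℕ) :
    (sendHash e q i b).result A B ω = hashBits e ω q ((lz77 A).take i) b := by
  induction b with
  | zero => rfl
  | succ b ih =>
    simp only [sendHash, result, result_bind, ih, hashBits]
    rfl

theorem length_trace_sendHash (q : ℕ × ℕ) (i b : ℕ) :
    ((sendHash e q i b).trace A B ω).length = b := by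
  induction b with
  | zero => rfl
  | succ b ih => simp [sendHash, trace, ih]

theorem fst_of_mem_trace_sendHash (q : ℕ × ℕ) (i b : ℕ) :
    ∀ t ∈ (sendHash e q i b).trace A B ω, t.1 = .alice := by
  induction b with
  | zero => simp [sendHash]
  | succ b ih =>
    simp only [sendHash, trace, trace_bind, List.nil_append, List.mem_append,
      List.mem_singleton]
    rintro t (ht | rfl)
    · exact ih t ht
    · rfl

/-- The answer to a query. -/
def answer (q : ℕ × ℕ) (i : ℕ) : Bool :=
  decide (∃ j, i ≤ (lz77 (B j)).length ∧
    hashBits e ω q ((lz77 (B j)).take i) b = hashBits e ω q ((lz77 A).take i) b)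

theorem result_query (q : ℕ × ℕ) (i : ℕ) :
    (query e b q i).result A B ω = answer e b A B ω q i := by
  simp only [query, result_bind, result_sendHash, result, answer, hashMatches, playerInput,
    decide_eq_true_eq]

theorem trace_query (q : ℕ × ℕ) (i : ℕ) :
    ((query e b q i).trace A B ω).length = b + 1 ∧
      Transcript.rounds ((query e b q i).trace A B ω) ≤ 2 := by
  simp only [query, trace_bind, trace, List.nil_append]
  constructor
  · simp [length_trace_sendHash]
  · refine (rounds_append_le _ _).trans ?_
    have := rounds_le_one (fst_of_mem_trace_sendHash (k := k) e A B ω q i b)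
    simp only [Transcript.rounds]
    omega

/-- The answers in a history of the search are those that are given in the protocol. -/
def IsHistory (D : ℕ) : List Bool → Prop
  | [] => True
  | a :: h => IsHistory D h ∧ a = answer e b A B ω (1, h.length) (searchIndex D h)

theorem result_search (D n : ℕ) {h : List Bool} (hh : IsHistory e b A B ω D h) :
    IsHistory e b A B ω D ((search e b D n h).result A B ω) ∧
      ((search e b D n h).result A B ω).length = h.length + n := by
  induction n generalizing h with
  | zero => exact ⟨hh, rfl⟩
  | succ n ih =>
    simp only [search, result_bind, result_query]
    obtain ⟨h1, h2⟩ := ih (h := answer e b A B ω (1, h.length) (searchIndex D h) :: h) ⟨hh, rfl⟩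
    exact ⟨h1, by rw [h2, List.length_cons]; omega⟩

theorem trace_search (D n : ℕ) (h : List Bool) :
    ((search e b D n h).trace A B ω).length = n * (b + 1) ∧
      Transcript.rounds ((search e b D n h).trace A B ω) ≤ 2 * n := by
  induction n generalizing h with
  | zero => simp [search, Transcript.rounds]
  | succ n ih =>
    simp only [search, trace_bind]
    obtain ⟨h1, h2⟩ := ih ((query e b (1, h.length) (searchIndex D h)).result A B ω :: h)
    obtain ⟨h3, h4⟩ := trace_query e b A B ω (1, h.length) (searchIndex D h)
    refine ⟨?_, (rounds_append_le _ _).trans (by omega)⟩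
    rw [List.length_append, h1, h3]
    ring

/-- Different phrases have the same hash in a query. -/
def Collision (q : ℕ × ℕ) (i : ℕ) : Prop :=
  ∃ j, (lz77 (B j)).take i ≠ (lz77 A).take i ∧
    hashBits e ω q ((lz77 (B j)).take i) b = hashBits e ω q ((lz77 A).take i) b

variable {A B ω}

theorem answer_of_sharesPhrases {q : ℕ × ℕ} {i : ℕ} (h : SharesPhrases A B i) :
    answer e b A B ω q i = true := by
  obtain ⟨j, h1, h2⟩ := h
  exact decide_eq_true ⟨j, h1, by rw [h2]⟩

variable {e b}

theorem collision_of_answer {q : ℕ × ℕ} {i : ℕ} (h : ¬ SharesPhrases A B i)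
    (ha : answer e b A B ω q i = true) : Collision e b A B ω q i := by
  obtain ⟨j, h1, h2⟩ := of_decide_eq_true ha
  exact ⟨j, fun h3 => h ⟨j, h1, h3⟩, h2⟩

/-- Bob checks the number of phrases exactly, so large `s` gives "no" whatever the coins are. This
is why the protocol always stops. -/
theorem exists_answer_eq_false :
    ∃ s, answer e b A B ω (0, s) (2 ^ 2 ^ s) = false := by
  set N := Finset.univ.sup fun j => (lz77 (B j)).length
  refine ⟨N, decide_eq_false ?_⟩
  rintro ⟨j, h, -⟩
  have h1 : (lz77 (B j)).length ≤ N :=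
    Finset.le_sup (f := fun j => (lz77 (B j)).length) (Finset.mem_univ j)
  have h2 : N < 2 ^ N := Nat.lt_two_pow_self
  have h3 : 2 ^ N < 2 ^ 2 ^ N := Nat.pow_lt_pow_right (by norm_num) h2
  omega

theorem stage_result_of_true {s : ℕ} (h : answer e b A B ω (0, s) (2 ^ 2 ^ s) = true) :
    (stage e b s).result A B ω = .inr (s + 1) ∧
      (stage e b s).trace A B ω = (query e b (0, s) (2 ^ 2 ^ s)).trace A B ω := by
  simp [stage, result_query, h]

theorem stage_result_of_false {s : ℕ} (h : answer e b A B ω (0, s) (2 ^ 2 ^ s) = false) :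
    (stage e b s).result A B ω =
      .inl ((finish e b (searchResult (2 ^ s)
        ((search e b (2 ^ s) (4 * 2 ^ s) []).result A B ω))).result A B ω) ∧
      (stage e b s).trace A B ω =
        (finish e b (searchResult (2 ^ s)
        ((search e b (2 ^ s) (4 * 2 ^ s) []).result A B ω))).trace A B ω ++
        (search e b (2 ^ s) (4 * 2 ^ s) []).trace A B ω ++
        (query e b (0, s) (2 ^ 2 ^ s)).trace A B ω := by
  simp [stage, result_query, h]

theorem exists_stopsWith :
    ∃ h, (loop (stage (k := k) e b) 0).StopsWith A B ω h := by
  classical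
  have hex := exists_answer_eq_false (e := e) (b := b) (A := A) (B := B) (ω := ω)
  obtain ⟨h, h1, -⟩ := stopsWith_loop (x := A) (y := B) (ω := ω) (unfold_stage (k := k) e b)
    (s := Nat.find hex) (fun i hi => (stage_result_of_true (by
      simpa using Nat.find_min hex hi)).1) (stage_result_of_false (Nat.find_spec hex)).1
  exact ⟨h, h1⟩

/-- The end of the protocol gives the right result if the number of common phrases has been found
and no collision occurs. -/
theorem finish_spec (hk : 1 ≤ k) {m : ℕ} (hm : ∀ i, SharesPhrases A B i ↔ i ≤ m)
    (hc : ¬ Collision e b A B ω (2, 0) m) {L : ℕ} (hL : maxLcp A B + 1 ≤ 2 ^ L) :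
    (finish e b m).result A B ω = maxLcp A B ∧
      ((finish e b m).trace A B ω).length ≤ b + (6 * L + 2) ∧
      Transcript.rounds ((finish e b m).trace A B ω) ≤ 2 := by
  have hs : SharesPhrases A B m := (hm m).2 le_rfl
  have hs' : ¬ SharesPhrases A B (m + 1) := fun h => absurd ((hm _).1 h) (by omega)
  set c := hashBits e ω (2, 0) ((lz77 A).take m) b with hcdef
  have hans : finalAnswer m (phraseCode A m) B (hashMatches e b (2, 0) m c B ω) =
      maxLcp A B := by
    -- Without a collision every matching string has the phrases of A, so all matches reproduce the
    -- same prefix of A.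
    have hval : ∀ j, hashMatches e b (2, 0) m c B ω j = true →
        maxLcp (extendByCode (phrasesText (B j) m) (phraseCode A m)) B = maxLcp A B := by
      intro j hj
      have hj := of_decide_eq_true hj
      have heq : (lz77 (B j)).take m = (lz77 A).take m := by
        by_contra hne
        exact hc ⟨j, hne, hj.2⟩
      have : phrasesText (B j) m = phrasesText A m := by rw [phrasesText, heq, phrasesText]
      rw [this, maxLcp_extendByCode hk hs hs']
    apply le_antisymm
    · refine Finset.sup_le fun j _ => ?_
      split
      · next h => exact (hval j h).le
      · exact Nat.zero_le _
    · obtain ⟨j, h1, h2⟩ := hs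
      have hj : hashMatches e b (2, 0) m c B ω j = true := decide_eq_true ⟨h1, by rw [h2]⟩
      refine le_trans ?_ (Finset.le_sup (Finset.mem_univ j))
      simp only [hj, if_true]
      exact (hval j hj).ge
  have hcode : phraseCode A m < 2 ^ (2 * L) := by
    refine (phraseCode_lt A m).trans_le ?_
    have := length_phrasesText_le_maxLcp hs
    rw [mul_comm, pow_mul]
    gcongr
    omega
  have hr : (sendNat (X := List σ) (Y := Fin k → List σ) .alice (2 * m + 2)
      (fun A _ => phraseCode A m) fun _ => measurable_const).result A B ω = phraseCode A m :=
    result_sendNat (p := .alice) _ (phraseCode_lt_two_pow A m)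
  have hfin : finalAnswer m (phraseCode A m) B (hashMatches e b (2, 0) m c B ω) <
      2 ^ (2 * m + 2) := by
    rw [hans]
    exact maxLcp_lt_two_pow hk hs hs'
  have hfinL : finalAnswer m (phraseCode A m) B (hashMatches e b (2, 0) m c B ω) < 2 ^ L := by
    rw [hans]
    omega
  simp only [finish, result_bind, trace_bind, result_sendHash, hr, ← hcdef]
  refine ⟨?_, ?_, ?_⟩
  · exact (result_sendNat (p := .bob) _ hfin).trans hans
  · have h1 := length_trace_sendNat (x := A) (y := B) (p := .bob) (ω := ω) (n := 2 * m + 2)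
      (f := fun B ω => finalAnswer m (phraseCode A m) B (hashMatches e b (2, 0) m c B ω))
      (fun B => (Measurable.of_discrete (f := finalAnswer m (phraseCode A m) B)).comp
            (measurable_hashMatches e b (2, 0) m c B)) hfinL
    have h2 := length_trace_sendNat (x := A) (y := B) (p := .alice) (ω := ω) (n := 2 * m + 2)
      (f := fun A _ => phraseCode A m) (fun _ => measurable_const) hcode
    simp only [List.length_append, length_trace_sendHash]
    omega
  · rw [List.append_assoc]
    refine (rounds_append_le _ _).trans (Nat.add_le_add (b := 1) (d := 1)
      (rounds_le_one (p := .bob) ?_)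
      (rounds_le_one (p := .alice) ?_))
    · exact fst_of_mem_trace_sendNat _
    · intro t ht
      rcases List.mem_append.1 ht with ht | ht
      · exact fst_of_mem_trace_sendNat (p := .alice) _ t ht
      · exact fst_of_mem_trace_sendHash e A B ω _ _ _ t ht

end Protocol

/-! ### Probability of failure -/

/-- The positions of the wrong answers `true` in a history, counted from the oldest answer. -/
def falseYesPositions (idx : List Bool → ℕ) (m : ℕ) : List Bool → Finset ℕ
  | [] => ∅
  | a :: h => if a = true ∧ m < idx h then insert h.length (falseYesPositions idx m h)
      else falseYesPositions idx m h

theorem lt_length_of_mem_falseYesPositions {idx : List Bool → ℕ} {m t : ℕ} {h : List Bool}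
    (ht : t ∈ falseYesPositions idx m h) : t < h.length := by
  induction h with
  | nil => simp [falseYesPositions] at ht
  | cons a h ih =>
    rw [falseYesPositions] at ht
    rw [List.length_cons]
    split at ht
    · rcases Finset.mem_insert.1 ht with rfl | ht
      · omega
      · have := ih ht; omega
    · have := ih ht; omega

theorem card_falseYesPositions (idx : List Bool → ℕ) (m : ℕ) (h : List Bool) :
    (falseYesPositions idx m h).card = falseYes idx m h := by
  induction h with
  | nil => rfl
  | cons a h ih =>
    rw [falseYesPositions, falseYes]
    split
    · rw [Finset.card_insert_of_notMem fun ht =>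
        absurd (lt_length_of_mem_falseYesPositions ht) (lt_irrefl _), ih]
    · rw [ih, add_zero]

section Failure

universe u

variable {σ : Type u} [DecidableEq σ] {k : ℕ} {e : (ℕ × ℕ) × ℕ × List (List σ) → ℕ} {b : ℕ}
variable {A : List σ} {B : Fin k → List σ} {ω : Coins} {m : ℕ}

theorem IsHistory.truthfulNo (hm : ∀ i, SharesPhrases A B i ↔ i ≤ m) {D : ℕ} {h : List Bool}
    (hh : IsHistory e b A B ω D h) : TruthfulNo (searchIndex D) m h := by
  induction h with
  | nil => trivial
  | cons a h ih =>
    refine ⟨ih hh.1, fun hle => ?_⟩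
    rw [hh.2]
    exact answer_of_sharesPhrases e b ((hm _).2 hle)

/-- Dropping all but the oldest `t` answers recovers the history at which question `t` was asked. -/
theorem IsHistory.collision (hm : ∀ i, SharesPhrases A B i ↔ i ≤ m) {D : ℕ} {h : List Bool}
    (hh : IsHistory e b A B ω D h) {t : ℕ} (ht : t ∈ falseYesPositions (searchIndex D) m h) :
    Collision e b A B ω (1, t) (searchIndex D (h.drop (h.length - t))) := by
  induction h with
  | nil => simp [falseYesPositions] at ht
  | cons a h ih =>
    have hold : t ∈ falseYesPositions (searchIndex D) m h →
        Collision e b A B ω (1, t) (searchIndex D ((a :: h).drop ((a :: h).length - t))) := by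
      intro ht
      have hlt := lt_length_of_mem_falseYesPositions ht
      rw [List.length_cons, Nat.succ_sub hlt.le, Nat.succ_eq_add_one, List.drop_succ_cons]
      exact ih hh.1 ht
    rw [falseYesPositions] at ht
    split at ht
    · next hf =>
      rcases Finset.mem_insert.1 ht with rfl | ht
      · have hd : (a :: h).drop ((a :: h).length - h.length) = h := by simp
        rw [hd]
        refine collision_of_answer (fun hs => ?_) (hh.2.symm.trans hf.1)
        have := (hm _).1 hs
        omega
      · exact hold ht
    · exact hold ht

/-- The event that the coins lead to more than `D / 2` wrong answers for some history of the
search. -/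
def ManyErrors (e : (ℕ × ℕ) × ℕ × List (List σ) → ℕ) (b : ℕ) (A : List σ) (B : Fin k → List σ)
    (m D : ℕ) (ω : Coins) : Prop :=
  ∃ f : Fin (4 * D) → Bool, D < 2 * falseYes (searchIndex D) m (List.ofFn f) ∧
    ∀ t ∈ falseYesPositions (searchIndex D) m (List.ofFn f),
      Collision e b A B ω (1, t)
        (searchIndex D ((List.ofFn f).drop ((List.ofFn f).length - t)))

theorem IsHistory.two_mul_falseYes_le (hm : ∀ i, SharesPhrases A B i ↔ i ≤ m) {D : ℕ}
    {h : List Bool} (hh : IsHistory e b A B ω D h) (hl : h.length = 4 * D)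
    (hc : ¬ ManyErrors e b A B m D ω) : 2 * falseYes (searchIndex D) m h ≤ D := by
  by_contra! hlt
  obtain ⟨f, rfl⟩ : ∃ f : Fin (4 * D) → Bool, List.ofFn f = h :=
    ⟨fun i => h.get (i.cast hl.symm), by
      apply List.ext_get <;> simp [hl]⟩
  exact hc ⟨f, hlt, fun t ht => hh.collision hm ht⟩

theorem coinMeasure_collision_le (he : Function.Injective e) (S : Finset (ℕ × ℕ))
    (i : ℕ × ℕ → ℕ) :
    coinMeasure {ω | ∀ q ∈ S, Collision e b A B ω q (i q)} ≤ (k * 2⁻¹ ^ b) ^ S.card :=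
  coinMeasure_collisions_le he S (fun q => (lz77 A).take (i q))
    fun q j => (lz77 (B j)).take (i q)

/-- The first `Nat.clog 2 k` hash bits pay for the union over Bob's strings; the other `c` bits give
the error bound. -/
theorem mul_two_inv_pow_le {c : ℕ} (hb : b = Nat.clog 2 k + c) :
    (k : ENNReal) * 2⁻¹ ^ b ≤ 2⁻¹ ^ c := by
  have h : (k : ENNReal) ≤ 2 ^ Nat.clog 2 k := by
    exact_mod_cast Nat.le_pow_clog (by norm_num) k
  calc (k : ENNReal) * 2⁻¹ ^ b ≤ 2 ^ Nat.clog 2 k * 2⁻¹ ^ b := by gcongr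
    _ = 2⁻¹ ^ c := by
      rw [hb, pow_add, ← mul_assoc, ← mul_pow, ENNReal.mul_inv_cancel (by simp) (by simp),
        one_pow, one_mul]

theorem coinMeasure_collision_single_le (he : Function.Injective e) {c : ℕ}
    (hb : b = Nat.clog 2 k + c) (q : ℕ × ℕ) (i : ℕ) :
    coinMeasure {ω | Collision e b A B ω q i} ≤ 2⁻¹ ^ c := by
  have := coinMeasure_collision_le (b := b) (A := A) (B := B) he {q} fun _ => i
  simp only [Finset.mem_singleton, forall_eq, Finset.card_singleton, pow_one] at this
  exact this.trans (mul_two_inv_pow_le hb)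

theorem coinMeasure_manyErrors_le (he : Function.Injective e) {a D : ℕ} (hD : 1 ≤ D)
    (hb : b = Nat.clog 2 k + (2 * a + 8)) :
    coinMeasure {ω | ManyErrors e b A B m D ω} ≤ 2⁻¹ ^ a := by
  have hsub : {ω | ManyErrors e b A B m D ω} ⊆ ⋃ f : Fin (4 * D) → Bool,
      {ω | D < 2 * falseYes (searchIndex D) m (List.ofFn f) ∧
        ∀ t ∈ falseYesPositions (searchIndex D) m (List.ofFn f),
          Collision e b A B ω (1, t)
            (searchIndex D ((List.ofFn f).drop ((List.ofFn f).length - t)))} := by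
    rintro ω ⟨f, hf⟩
    exact Set.mem_iUnion.2 ⟨f, hf⟩
  have hone : ∀ f : Fin (4 * D) → Bool,
      coinMeasure {ω | D < 2 * falseYes (searchIndex D) m (List.ofFn f) ∧
        ∀ t ∈ falseYesPositions (searchIndex D) m (List.ofFn f),
          Collision e b A B ω (1, t)
            (searchIndex D ((List.ofFn f).drop ((List.ofFn f).length - t)))} ≤
        2⁻¹ ^ ((a + 4) * D) := by
    intro f
    set h := List.ofFn f
    by_cases hD : D < 2 * falseYes (searchIndex D) m h
    · set S := (falseYesPositions (searchIndex D) m h).image fun t => ((1, t) : ℕ × ℕ) with hS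
      have hcard : S.card = falseYes (searchIndex D) m h := by
        rw [hS, Finset.card_image_of_injective _ (Prod.mk_right_injective 1),
          card_falseYesPositions]
      calc _ ≤ coinMeasure {ω | ∀ q ∈ S, Collision e b A B ω q
              (searchIndex D (h.drop (h.length - q.2)))} := by
            refine measure_mono ?_
            rintro ω ⟨-, hω⟩ q hq
            obtain ⟨t, ht, rfl⟩ := Finset.mem_image.1 hq
            exact hω t ht
        _ ≤ (k * 2⁻¹ ^ b) ^ S.card := coinMeasure_collision_le he S _
        _ ≤ (2⁻¹ ^ (2 * a + 8)) ^ S.card := by gcongr; exact mul_two_inv_pow_le hb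
        _ = 2⁻¹ ^ ((2 * a + 8) * S.card) := (pow_mul _ _ _).symm
        -- More than D/2 errors, each contributing 2a + 8 in the exponent; the surplus 4D cancels
        -- the 2^(4D) histories below.
        _ ≤ 2⁻¹ ^ ((a + 4) * D) := by
            refine pow_le_pow_right_of_le_one' (by simp) ?_
            rw [hcard]
            calc (a + 4) * D ≤ (a + 4) * (2 * falseYes (searchIndex D) m h) := by gcongr
              _ = _ := by ring
    · simp [hD]
  calc _ ≤ _ := measure_mono hsub
    _ ≤ _ := measure_iUnion_fintype_le _ _
    _ ≤ ∑ f : Fin (4 * D) → Bool, 2⁻¹ ^ ((a + 4) * D) := Finset.sum_le_sum fun f _ => hone f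
    _ = 2⁻¹ ^ (a * D) := by
      rw [Finset.sum_const, Finset.card_univ, Fintype.card_fun, Fintype.card_fin,
        Fintype.card_bool, nsmul_eq_mul, add_mul, pow_add, mul_comm (2⁻¹ ^ (a * D)), ← mul_assoc]
      push_cast
      rw [← mul_pow, ENNReal.mul_inv_cancel (by simp) (by simp), one_pow, one_mul]
    _ ≤ 2⁻¹ ^ a := pow_le_pow_right_of_le_one' (by simp) (Nat.le_mul_of_pos_right a hD)

open Interaction in
/-- A run without collisions in the relevant queries. -/
theorem stopsWith_of_not_collision (hk : 1 ≤ k) (hm : ∀ i, SharesPhrases A B i ↔ i ≤ m) {s L : ℕ}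
    (hs : m < 2 ^ 2 ^ s) (hlt : ∀ i < s, 2 ^ 2 ^ i ≤ m) (hL : maxLcp A B + 1 ≤ 2 ^ L)
    (h1 : ¬ Collision e b A B ω (0, s) (2 ^ 2 ^ s)) (h2 : ¬ ManyErrors e b A B m (2 ^ s) ω)
    (h3 : ¬ Collision e b A B ω (2, 0) m) :
    ∃ h, (loop (stage (k := k) e b) 0).StopsWith A B ω h ∧
      (loop (stage (k := k) e b) 0).output ω h = maxLcp A B ∧
      Transcript.rounds h ≤ 14 * 2 ^ s ∧
      Transcript.bits h ≤ 6 * 2 ^ s * (b + 1) + (6 * L + 2) := by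
  -- The earlier tests have true answer "yes", which cannot be misreported, so only stage `s`
  -- carries a risk.
  have htrue : ∀ i < s, answer e b A B ω (0, i) (2 ^ 2 ^ i) = true := fun i hi =>
    answer_of_sharesPhrases e b ((hm _).2 (hlt i hi))
  have hfalse : answer e b A B ω (0, s) (2 ^ 2 ^ s) = false := by
    by_contra hne
    refine h1 (collision_of_answer (fun h => ?_) (by simpa using hne))
    have := (hm _).1 h
    omega
  obtain ⟨hres, htr⟩ := stage_result_of_false hfalse
  obtain ⟨hh, hl⟩ := result_search e b A B ω (2 ^ s) (4 * 2 ^ s) (h := []) trivial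
  rw [List.length_nil, zero_add] at hl
  rw [searchResult_eq hs hl (hh.truthfulNo hm) (hh.two_mul_falseYes_le hm hl h2)] at hres htr
  obtain ⟨hfin, hbits, hrounds⟩ := finish_spec hk hm h3 hL
  rw [hfin] at hres
  obtain ⟨h, hend, hout, hh⟩ := stopsWith_loop (unfold_stage (k := k) e b)
    (fun i hi => (stage_result_of_true (htrue i hi)).1) hres
  obtain ⟨hb1, hr1⟩ := trace_search e b A B ω (2 ^ s) (4 * 2 ^ s) []
  obtain ⟨hb2, hr2⟩ := trace_query e b A B ω (0, s) (2 ^ 2 ^ s)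
  -- Gives s + 2 ≤ 2 * 2 ^ s, so the doubling tests cost no more than the search up to a constant.
  have hs2 : s < 2 ^ s := Nat.lt_two_pow_self
  have hmap : (List.range s).map (fun i => (stage e b i).trace A B ω) =
      (List.range s).map fun i => (query e b (0, i) (2 ^ 2 ^ i)).trace A B ω :=
    List.map_congr_left fun i hi => (stage_result_of_true (htrue i (List.mem_range.1 hi))).2
  have hbits0 : ∀ n, (((List.range n).map fun i =>
      (query (k := k) e b (0, i) (2 ^ 2 ^ i)).trace A B ω).reverse).flatten.length =
        n * (b + 1) := by
    intro n
    induction n with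
    | zero => simp
    | succ n ih =>
      rw [List.range_succ, List.map_append, List.reverse_append, List.flatten_append,
        List.length_append, ih]
      simp only [List.map_cons, List.map_nil, List.reverse_singleton, List.flatten_singleton]
      rw [(trace_query e b A B ω (0, n) (2 ^ 2 ^ n)).1]
      ring
  have hrounds0 : ∀ n, Transcript.rounds (((List.range n).map fun i =>
      (query (k := k) e b (0, i) (2 ^ 2 ^ i)).trace A B ω).reverse).flatten ≤ 2 * n := by
    intro n
    induction n with
    | zero => simp [Transcript.rounds]
    | succ n ih =>
      rw [List.range_succ, List.map_append, List.reverse_append, List.flatten_append]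
      refine (rounds_append_le _ _).trans ?_
      simp only [List.map_cons, List.map_nil, List.reverse_singleton, List.flatten_singleton]
      have := (trace_query e b A B ω (0, n) (2 ^ 2 ^ n)).2
      omega
  rw [List.range_succ, List.map_append, List.reverse_append, List.flatten_append, hmap] at hh
  simp only [List.map_cons, List.map_nil, List.reverse_singleton, List.flatten_singleton,
    htr] at hh
  refine ⟨h, hend, hout, ?_, ?_⟩
  · rw [hh]
    have i1 := rounds_append_le ((finish e b m).trace A B ω ++
      (search e b (2 ^ s) (4 * 2 ^ s) []).trace A B ω ++
        (query e b (0, s) (2 ^ 2 ^ s)).trace A B ω) (((List.range s).map fun i =>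
      (query (k := k) e b (0, i) (2 ^ 2 ^ i)).trace A B ω).reverse).flatten
    have i2 := rounds_append_le ((finish e b m).trace A B ω ++
      (search e b (2 ^ s) (4 * 2 ^ s) []).trace A B ω)
        ((query e b (0, s) (2 ^ 2 ^ s)).trace A B ω)
    have i3 := rounds_append_le ((finish e b m).trace A B ω)
      ((search e b (2 ^ s) (4 * 2 ^ s) []).trace A B ω)
    have i4 := hrounds0 s
    omega
  · rw [hh, Transcript.bits]
    simp only [List.length_append, hb1, hb2, hbits0]
    calc _ ≤ b + (6 * L + 2) + 4 * 2 ^ s * (b + 1) + (b + 1) + s * (b + 1) := by omega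
      _ ≤ (s + 2 + 4 * 2 ^ s) * (b + 1) + (6 * L + 2) := by
        rw [add_mul, add_mul]; omega
      _ ≤ _ := by gcongr; omega

end Failure

/-! ### Numerical estimates and the main theorem -/

theorem exists_least_double_exponent (m : ℕ) :
    ∃ s, m < 2 ^ 2 ^ s ∧ ∀ i < s, 2 ^ 2 ^ i ≤ m := by
  have hex : ∃ s, m < 2 ^ 2 ^ s :=
    ⟨m, Nat.lt_two_pow_self.trans (Nat.pow_lt_pow_right (by norm_num) Nat.lt_two_pow_self)⟩
  exact ⟨Nat.find hex, Nat.find_spec hex, fun i hi => not_lt.1 (Nat.find_min hex hi)⟩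

/-- By minimality of `s` the previous test value 2^(2^(s-1)) is at most m ≤ z; taking logarithms
bounds D = 2^s. -/
theorem two_pow_le_two_mul_logb {m z s : ℕ} (hlt : ∀ i < s, 2 ^ 2 ^ i ≤ m) (hz : m ≤ z) :
    (2 : ℝ) ^ s ≤ 2 * Real.logb 2 (z + 2) := by
  have hpos : (0 : ℝ) < z + 2 := by positivity
  cases s with
  | zero =>
    have : 1 ≤ Real.logb 2 (z + 2) := by
      rw [Real.le_logb_iff_rpow_le (by norm_num) hpos, Real.rpow_one]
      linarith [(Nat.cast_nonneg z : (0 : ℝ) ≤ z)]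
    simp only [pow_zero]
    linarith
  | succ s =>
    have h : (2 : ℝ) ^ s ≤ Real.logb 2 (z + 2) := by
      rw [Real.le_logb_iff_rpow_le (by norm_num) hpos]
      have h1 : ((2 ^ 2 ^ s : ℕ) : ℝ) ≤ z := by exact_mod_cast (hlt s (by omega)).trans hz
      have h2 : (2 : ℝ) ^ ((2 : ℝ) ^ s) = ((2 ^ 2 ^ s : ℕ) : ℝ) := by
        have : ((2 : ℝ) ^ s) = ((2 ^ s : ℕ) : ℝ) := by push_cast; rfl
        rw [this, Real.rpow_natCast]
        push_cast
        rfl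
      rw [h2]
      linarith
    rw [pow_succ]
    linarith

theorem clog_le_logb_add_one {k : ℕ} (hk : 1 ≤ k) :
    (Nat.clog 2 k : ℝ) ≤ Real.logb 2 k + 1 := by
  rw [← Real.natCeil_logb_natCast]
  have h0 : 0 ≤ Real.logb 2 k := Real.logb_nonneg (by norm_num) (by exact_mod_cast hk)
  exact_mod_cast (Nat.ceil_lt_add_one h0).le

instance : IsProbabilityMeasure coinMeasure := by
  unfold coinMeasure
  infer_instance

theorem theorem2 (ε : ℝ) (hε0 : 0 < ε) (hε1 : ε < 1 / 2) :
    ∃ C : ℝ, ∀ (σ : Type*) [Fintype σ] [DecidableEq σ] (k : ℕ), 1 ≤ k →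
      ∃ P : PublicCoinProtocol (List σ) (Fin k → List σ) ℕ,
        (∀ (A : List σ) (B : Fin k → List σ) (ω : Coins), ∃ h, P.StopsWith A B ω h) ∧
        ∀ (A : List σ) (B : Fin k → List σ) (ℓ z : ℕ),
          ℓ = maxLcp A B → z = (lz77 (A.take ℓ)).length →
          ENNReal.ofReal (1 - ε) ≤ coinMeasure {ω | ∃ h, P.StopsWith A B ω h ∧
            P.output ω h = ℓ ∧
            (Transcript.rounds h : ℝ) ≤ C * Real.logb 2 (z + 2) ∧
            (Transcript.bits h : ℝ) ≤
              C * (Real.logb 2 (z + 2) * Real.logb 2 k + Real.logb 2 (ℓ + 2))} := by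
  obtain ⟨a, ha⟩ : ∃ a : ℕ, (2⁻¹ : ℝ) ^ a < ε / 3 :=
    exists_pow_lt_of_lt_one (by positivity) (by norm_num)
  -- With 2^s ≤ 2Z and b + 1 ≤ K + 2a + 10, the bits are at most 12ZK + 12(2a + 10)Z + 6Λ + 8; since
  -- 1 ≤ Z ≤ Λ the constant suffices, with room to spare.
  refine ⟨12 * (2 * a + 8) + 60, ?_⟩
  intro σ _ _ k hk
  -- As Σ is finite, these triples are countable; `e` gives each query, hash bit and phrase list its
  -- own coin.
  obtain ⟨e, he⟩ := exists_injective_nat ((ℕ × ℕ) × ℕ × List (List σ))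
  set b := Nat.clog 2 k + (2 * a + 8) with hb
  refine ⟨Interaction.loop (stage (k := k) e b) 0, fun A B ω => exists_stopsWith, ?_⟩
  rintro A B ℓ z hℓ hz
  obtain ⟨m, hm⟩ := exists_forall_sharesPhrases_iff hk A B
  obtain ⟨s, hs, hlt⟩ := exists_least_double_exponent m
  have hmz : m ≤ z := by
    rw [hz, hℓ]
    exact le_length_lz77_take_maxLcp ((hm m).2 le_rfl)
  have hzℓ : z ≤ ℓ := by
    rw [hz]
    exact (length_lz77From_le [] _).trans (by simp)
  set L := Nat.clog 2 (ℓ + 1) with hLdef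
  have hL : maxLcp A B + 1 ≤ 2 ^ L := by
    rw [← hℓ]
    exact Nat.le_pow_clog (by norm_num) _
  have hD := two_pow_le_two_mul_logb hlt hmz
  have hK := clog_le_logb_add_one hk
  have hK0 : 0 ≤ Real.logb 2 k := Real.logb_nonneg (by norm_num) (by exact_mod_cast hk)
  have hLr : (L : ℝ) ≤ Real.logb 2 (ℓ + 2) + 1 := by
    refine (clog_le_logb_add_one (k := ℓ + 1) (by omega)).trans ?_
    push_cast
    gcongr
    · norm_num
    · norm_num
  have hZ1 : 1 ≤ Real.logb 2 (z + 2) := by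
    rw [Real.le_logb_iff_rpow_le (by norm_num) (by positivity), Real.rpow_one]
    linarith [(Nat.cast_nonneg z : (0 : ℝ) ≤ z)]
  have hZL : Real.logb 2 (z + 2) ≤ Real.logb 2 (ℓ + 2) := by
    gcongr
    norm_num
  set Z := Real.logb 2 (z + 2)
  set K := Real.logb 2 k
  set Λ := Real.logb 2 (ℓ + 2)
  set good := {ω | ∃ h, (Interaction.loop (stage (k := k) e b) 0).StopsWith A B ω h ∧
    (Interaction.loop (stage (k := k) e b) 0).output ω h = ℓ ∧
    (Transcript.rounds h : ℝ) ≤ (12 * (2 * a + 8) + 60) * Z ∧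
    (Transcript.bits h : ℝ) ≤ (12 * (2 * a + 8) + 60) * (Z * K + Λ)}
  have hcover : Set.univ ⊆ good ∪ ({ω | Collision e b A B ω (0, s) (2 ^ 2 ^ s)} ∪
      {ω | ManyErrors e b A B m (2 ^ s) ω} ∪ {ω | Collision e b A B ω (2, 0) m}) := by
    intro ω _
    by_contra hω
    simp only [Set.mem_union, not_or] at hω
    obtain ⟨h0, ⟨h1, h2⟩, h3⟩ := hω
    obtain ⟨h, hend, hout, hr, hbt⟩ := stopsWith_of_not_collision hk hm hs hlt hL h1 h2 h3
    refine h0 ⟨h, hend, hout.trans hℓ.symm, ?_, ?_⟩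
    · have hr' : (Transcript.rounds h : ℝ) ≤ 14 * 2 ^ s := by exact_mod_cast hr
      have : 0 ≤ (a : ℝ) * Z := by positivity
      nlinarith
    · have hbt' : (Transcript.bits h : ℝ) ≤ 6 * 2 ^ s * (b + 1) + (6 * L + 2) := by
        exact_mod_cast hbt
      have hb' : (b : ℝ) + 1 ≤ K + (2 * a + 10) := by
        rw [hb]
        push_cast
        linarith
      have h4 : 6 * (2 : ℝ) ^ s * (b + 1) ≤ 6 * (2 * Z) * (K + (2 * a + 10)) := by
        gcongr
      have h5 : (2 * a + 10) * Z ≤ (2 * a + 10) * Λ := by gcongr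
      have h6 : 0 ≤ Z * K := by positivity
      have h7 : 0 ≤ (a : ℝ) * (Z * K) := by positivity
      nlinarith
  -- Covering the whole space needs only subadditivity, so the measurability of the good event plays
  -- no role.
  have hmeas : 1 ≤ coinMeasure good + (2⁻¹ ^ a + 2⁻¹ ^ a + 2⁻¹ ^ a) := by
    have hpow : (2⁻¹ : ENNReal) ^ (2 * a + 8) ≤ 2⁻¹ ^ a :=
      pow_le_pow_right_of_le_one' (by simp) (by omega)
    calc 1 = coinMeasure Set.univ := measure_univ.symm
      _ ≤ _ := measure_mono hcover
      _ ≤ _ := measure_union_le _ _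
      _ ≤ _ := by
        gcongr
        refine (measure_union_le _ _).trans ?_
        gcongr
        · refine (measure_union_le _ _).trans ?_
          gcongr
          · exact (coinMeasure_collision_single_le he hb _ _).trans hpow
          · exact coinMeasure_manyErrors_le he Nat.one_le_two_pow hb
        · exact (coinMeasure_collision_single_le he hb _ _).trans hpow
  have hε : (2⁻¹ : ENNReal) ^ a + 2⁻¹ ^ a + 2⁻¹ ^ a ≤ ENNReal.ofReal ε := by
    have : (2⁻¹ : ENNReal) ^ a = ENNReal.ofReal (2⁻¹ ^ a) := by
      rw [ENNReal.ofReal_pow (by norm_num), ENNReal.ofReal_inv_of_pos (by norm_num)]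
      simp
    rw [this, ← ENNReal.ofReal_add (by positivity) (by positivity),
      ← ENNReal.ofReal_add (by positivity) (by positivity)]
    exact ENNReal.ofReal_le_ofReal (by linarith)
  rw [ENNReal.ofReal_sub _ hε0.le, ENNReal.ofReal_one, tsub_le_iff_right]
  exact hmeas.trans (by gcongr)
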